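/- Let $\mathbb K\in\{\mathbb R,\mathbb C\}$, let $E$ be a locally convex Hausdorff space over $\mathbb K$, let $\Omega\subset\mathbb R^d$ be open and let $k\in\mathbb N_0\cup\{\infty\}$. Let $\mathcal{CW}^k(\Omega,E)$ be the space of $k$-times continuously partially differentiable functions $f\colon\Omega\to E$ (partial derivatives are limits of difference quotients in $E$; for $k=\infty$: $\mathcal C^m$ for every finite $m$; $\mathcal C^0$ means continuous), with the topology of uniform convergence of all partial derivatives $\partial^\beta f$, $|\beta|\le k$, on the compact subsets of $\Omega$, and put $\mathcal{CW}^k(\Omega):=\mathcal{CW}^k(\Omega,\mathbb K)$. For a locally convex Hausdorff space $F$ let $F\varepsilon E:=L_e(F'_\kappa,E)$ be the space of continuous linear maps $F'_\kappa\to E$ with the topology of uniform convergence on the equicontinuous subsets of $F'$, where $F'_\kappa$ is the dual of $F$ with the topology of uniform convergence on the absolutely convex compact subsets of $F$. Suppose that one of the following holds: (i) $k<\infty$ and $E$ has the metric convex compactness property, i.e. the closure of the absolutely convex hull of every metrisable compact subset of $E$ is compact; (ii) $k=\infty$ and $E$ is locally complete, i.e. for every closed, bounded, absolutely convex set $D\subset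 E$ the space $E_D=\bigcup_{n\ge1}nD$, normed by the gauge of $D$, is a Banach space. Then $\mathcal{CW}^k(\Omega,E)\cong\mathcal{CW}^k(\Omega)\,\varepsilon\,E$; more precisely, the map $$S\colon\mathcal{CW}^k(\Omega)\,\varepsilon\,E\to\mathcal{CW}^k(\Omega,E),\qquad S(u)(x)=u(\delta_x),\quad \delta_x(f)=f(x),$$ is a well-defined linear topological isomorphism. -/

import Mathlib

open Filter Topology Set TopologicalSpace
open scoped ComplexOrder UniformConvergence Pointwise

/-! ### Completeness conditions on a locally convex Hausdorff space -/

/-- The metric convex compactness property (metric ccp): the closure of the absolutely convex hull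
of every metrisable compact set is compact. -/
def HasMetricCCP (𝕜 E : Type*) [RCLike 𝕜] [AddCommGroup E] [Module 𝕜 E] [TopologicalSpace E] :
    Prop :=
  ∀ K : Set E, IsCompact K → MetrizableSpace K → IsCompact (closure (absConvexHull 𝕜 K))

/-- A disk: a bounded, absolutely convex set. -/
def IsDisk (𝕜 : Type*) {E : Type*} [RCLike 𝕜] [AddCommGroup E] [Module 𝕜 E] [TopologicalSpace E]
    (D : Set E) : Prop :=
  Bornology.IsVonNBounded 𝕜 D ∧ AbsConvex 𝕜 D

/-- The underlying set of `E_D = ⋃_{n ≥ 1} n D`. -/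
def diskSpace {E : Type*} [AddCommGroup E] [Module ℝ E] (D : Set E) : Set E :=
  {x | ∃ n : ℕ, 0 < n ∧ x ∈ (n : ℝ) • D}

/-- Local completeness: for every closed disk `D`, the space `E_D`, normed by the gauge of `D`,
is a Banach space, i.e. every gauge-Cauchy sequence in `E_D` converges in `E_D` for the gauge. -/
def IsLocallyComplete (𝕜 E : Type*) [RCLike 𝕜] [AddCommGroup E] [Module 𝕜 E] [Module ℝ E]
    [TopologicalSpace E] : Prop :=
  ∀ D : Set E, IsClosed D → IsDisk 𝕜 D →
    ∀ x : ℕ → E, (∀ n, x n ∈ diskSpace D) →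
      (∀ ε > 0, ∃ N, ∀ m ≥ N, ∀ n ≥ N, gauge D (x m - x n) < ε) →
      ∃ y ∈ diskSpace D, Tendsto (fun n => gauge D (x n - y)) atTop (𝓝 0)

/-! ### Partial derivatives and the spaces of `k`-times continuously differentiable functions -/

section Derivatives

variable {E : Type*} [AddCommGroup E] [Module ℝ E] {d : ℕ}
  {Ω : Opens (EuclideanSpace ℝ (Fin d))}

/-- The difference quotient `(f (x + h eₙ) - f x) / h`. As `Ω` is open, `x + h eₙ ∈ Ω` for
small `h`; outside `Ω` the function is (irrelevantly) extended by `0`. -/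
noncomputable def diffQuot (n : Fin d) (f : Ω → E) (x : Ω) (h : ℝ) : E :=
  h⁻¹ • (Function.extend Subtype.val f 0 ((x : EuclideanSpace ℝ (Fin d)) +
    h • EuclideanSpace.single n (1 : ℝ)) - f x)

theorem diffQuot_zero (n : Fin d) (x : Ω) : diffQuot n (0 : Ω → E) x = 0 := by
  funext h
  have : Function.extend Subtype.val (0 : Ω → E) (0 : EuclideanSpace ℝ (Fin d) → E) = 0 := by
    funext y
    by_cases hy : ∃ a : Ω, (a : EuclideanSpace ℝ (Fin d)) = y
    · obtain ⟨a, rfl⟩ := hy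
      simp
    · simp [Function.extend_apply' _ _ _ hy]
  simp [diffQuot, this]

theorem diffQuot_add (n : Fin d) (f g : Ω → E) (x : Ω) :
    diffQuot n (f + g) x = diffQuot n f x + diffQuot n g x := by
  funext h
  have : Function.extend Subtype.val (f + g) (0 : EuclideanSpace ℝ (Fin d) → E) =
      Function.extend Subtype.val f 0 + Function.extend Subtype.val g 0 := by
    funext y
    by_cases hy : ∃ a : Ω, (a : EuclideanSpace ℝ (Fin d)) = y
    · obtain ⟨a, rfl⟩ := hy
      simp
    · simp [Function.extend_apply' _ _ _ hy]
  simp only [diffQuot, this, Pi.add_apply, ← smul_add]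
  congr 1
  abel

theorem diffQuot_smul {𝕜 : Type*} [RCLike 𝕜] [Module 𝕜 E] [IsScalarTower ℝ 𝕜 E]
    (n : Fin d) (c : 𝕜) (f : Ω → E) (x : Ω) :
    diffQuot n (c • f) x = c • diffQuot n f x := by
  funext h
  have : Function.extend Subtype.val (c • f) (0 : EuclideanSpace ℝ (Fin d) → E) =
      c • Function.extend Subtype.val f 0 := by
    funext y
    by_cases hy : ∃ a : Ω, (a : EuclideanSpace ℝ (Fin d)) = y
    · obtain ⟨a, rfl⟩ := hy
      simp
    · simp [Function.extend_apply' _ _ _ hy]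
  have : SMulCommClass ℝ 𝕜 E := IsScalarTower.to_smulCommClass
  simp only [diffQuot, *, Pi.smul_apply, ← smul_sub]
  exact smul_comm _ _ _

variable [TopologicalSpace E]

/-- The `n`-th partial derivative of `f` exists (in `E`) at every point of `Ω`. -/
def HasPartial (n : Fin d) (f : Ω → E) : Prop :=
  ∀ x : Ω, ∃ l : E, Tendsto (diffQuot n f x) (𝓝[≠] 0) (𝓝 l)

/-- The `n`-th partial derivative of `f` (meaningful if `HasPartial n f`). -/
noncomputable def partialDer (n : Fin d) (f : Ω → E) : Ω → E :=
  fun x => limUnder (𝓝[≠] (0 : ℝ)) (diffQuot n f x)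

/-- `f` is `C⁰` if it is continuous; it is `C^{m+1}` if all its first partial derivatives exist,
are continuous (i.e. `f` is `C¹`) and are themselves `C^m`. -/
def IsC : ℕ → (Ω → E) → Prop
  | 0, f => Continuous f
  | m + 1, f => (∀ n, HasPartial n f ∧ Continuous (partialDer n f)) ∧ ∀ n, IsC m (partialDer n f)

/-- `∂^β f = ∂₁^{β₁} ⋯ ∂_d^{β_d} f`. -/
noncomputable def iterPartial (β : Fin d → ℕ) (f : Ω → E) : Ω → E :=
  (List.finRange d).foldr (fun n g => (partialDer n)^[β n] g) f

theorem HasPartial.tendsto {n : Fin d} {f : Ω → E} (hf : HasPartial n f) (x : Ω) :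
    Tendsto (diffQuot n f x) (𝓝[≠] 0) (𝓝 (partialDer n f x)) :=
  tendsto_nhds_limUnder (hf x)

theorem partialDer_eq [T2Space E] {n : Fin d} {f : Ω → E} {x : Ω} {l : E}
    (h : Tendsto (diffQuot n f x) (𝓝[≠] 0) (𝓝 l)) : partialDer n f x = l :=
  h.limUnder_eq

theorem tendsto_diffQuot_add [ContinuousAdd E] {n : Fin d} {f g : Ω → E}
    (hf : HasPartial n f) (hg : HasPartial n g) (x : Ω) :
    Tendsto (diffQuot n (f + g) x) (𝓝[≠] 0) (𝓝 (partialDer n f x + partialDer n g x)) := by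
  rw [diffQuot_add]
  exact (hf.tendsto x).add (hg.tendsto x)

theorem tendsto_diffQuot_smul {𝕜 : Type*} [RCLike 𝕜] [Module 𝕜 E] [IsScalarTower ℝ 𝕜 E]
    [ContinuousConstSMul 𝕜 E] (c : 𝕜) {n : Fin d} {f : Ω → E} (hf : HasPartial n f) (x : Ω) :
    Tendsto (diffQuot n (c • f) x) (𝓝[≠] 0) (𝓝 (c • partialDer n f x)) := by
  rw [diffQuot_smul]
  exact (hf.tendsto x).const_smul c

theorem IsC.zero [T2Space E] (m : ℕ) : IsC m (0 : Ω → E) := by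
  induction m with
  | zero => exact continuous_zero
  | succ m ih =>
    have h (n : Fin d) (x : Ω) : Tendsto (diffQuot n (0 : Ω → E) x) (𝓝[≠] 0) (𝓝 0) := by
      rw [diffQuot_zero]
      exact tendsto_const_nhds
    have h0 (n : Fin d) : partialDer n (0 : Ω → E) = 0 := funext fun x => partialDer_eq (h n x)
    refine ⟨fun n => ⟨fun x => ⟨0, h n x⟩, ?_⟩, fun n => ?_⟩
    · rw [h0]; exact continuous_zero
    · rw [h0]; exact ih

theorem IsC.add [T2Space E] [ContinuousAdd E] {m : ℕ} {f g : Ω → E}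
    (hf : IsC m f) (hg : IsC m g) : IsC m (f + g) := by
  induction m generalizing f g with
  | zero => exact Continuous.add hf hg
  | succ m ih =>
    have h0 (n : Fin d) : partialDer n (f + g) = partialDer n f + partialDer n g :=
      funext fun x => partialDer_eq (tendsto_diffQuot_add (hf.1 n).1 (hg.1 n).1 x)
    refine ⟨fun n => ⟨fun x => ⟨_, tendsto_diffQuot_add (hf.1 n).1 (hg.1 n).1 x⟩, ?_⟩, fun n => ?_⟩
    · rw [h0]; exact (hf.1 n).2.add (hg.1 n).2
    · rw [h0]; exact ih (hf.2 n) (hg.2 n)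

theorem IsC.smul [T2Space E] {𝕜 : Type*} [RCLike 𝕜] [Module 𝕜 E] [IsScalarTower ℝ 𝕜 E]
    [ContinuousConstSMul 𝕜 E] (c : 𝕜) {m : ℕ} {f : Ω → E} (hf : IsC m f) : IsC m (c • f) := by
  induction m generalizing f with
  | zero => exact Continuous.const_smul hf c
  | succ m ih =>
    have h0 (n : Fin d) : partialDer n (c • f) = c • partialDer n f :=
      funext fun x => partialDer_eq (tendsto_diffQuot_smul c (hf.1 n).1 x)
    refine ⟨fun n => ⟨fun x => ⟨_, tendsto_diffQuot_smul c (hf.1 n).1 x⟩, ?_⟩, fun n => ?_⟩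
    · rw [h0]; exact (hf.1 n).2.const_smul c
    · rw [h0]; exact ih (hf.2 n)

end Derivatives

section CkSpace

variable (𝕜 : Type*) [RCLike 𝕜] {d : ℕ} (k : ℕ∞) (Ω : Opens (EuclideanSpace ℝ (Fin d)))
  (E : Type*) [AddCommGroup E] [Module 𝕜 E] [Module ℝ E] [IsScalarTower ℝ 𝕜 E]
  [UniformSpace E] [IsUniformAddGroup E] [ContinuousSMul 𝕜 E] [T2Space E]

/-- The linear space of all `f : Ω → E` that are `C^m` for every finite `m ≤ k`. -/
def ckSubmodule : Submodule 𝕜 (Ω → E) where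
  carrier := {f | ∀ m : ℕ, (m : ℕ∞) ≤ k → IsC m f}
  add_mem' hf hg m hm := (hf m hm).add (hg m hm)
  zero_mem' m _ := IsC.zero m
  smul_mem' c _ hf m hm := (hf m hm).smul c

/-- The space `CW^k(Ω, E)`: the `C^k` functions `Ω → E`, with the topology of uniform convergence
of all partial derivatives of order at most `k` on the compact subsets of `Ω`. It is a separate
type, so that it does not carry the topology of pointwise convergence of `Ω → E`. -/
def CW : Type _ := ckSubmodule 𝕜 k Ω E

namespace CW

noncomputable instance : AddCommGroup (CW 𝕜 k Ω E) :=
  inferInstanceAs (AddCommGroup (ckSubmodule 𝕜 k Ω E))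

noncomputable instance : Module 𝕜 (CW 𝕜 k Ω E) :=
  inferInstanceAs (Module 𝕜 (ckSubmodule 𝕜 k Ω E))

instance : CoeFun (CW 𝕜 k Ω E) (fun _ => Ω → E) := ⟨fun f => f.1⟩

noncomputable instance : TopologicalSpace (CW 𝕜 k Ω E) :=
  ⨅ β : {β : Fin d → ℕ // ((∑ n, β n : ℕ) : ℕ∞) ≤ k},
    TopologicalSpace.induced
      (fun f : CW 𝕜 k Ω E => UniformOnFun.ofFun {K : Set Ω | IsCompact K} (iterPartial β.1 f))
      inferInstance

end CW

end CkSpace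

/-! ### The `ε`-product of Schwartz -/

section EpsProduct

variable (𝕜 : Type*) [RCLike 𝕜] (F : Type*) [AddCommGroup F] [Module 𝕜 F] [TopologicalSpace F]
  (E : Type*) [AddCommGroup E] [Module 𝕜 E] [TopologicalSpace E]

/-- `F'_κ`: the continuous dual of `F` with the topology of uniform convergence on the absolutely
convex, compact subsets of `F`. -/
abbrev KappaDual : Type _ :=
  UniformConvergenceCLM (RingHom.id 𝕜) 𝕜 {K : Set F | AbsConvex 𝕜 K ∧ IsCompact K}

/-- `F ε E = L_e(F'_κ, E)`: the continuous linear maps `F'_κ → E` with the topology of uniform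
convergence on the equicontinuous subsets of `F'`. -/
abbrev EpsProduct : Type _ :=
  UniformConvergenceCLM (RingHom.id 𝕜) E
    {H : Set (KappaDual 𝕜 F) | Equicontinuous fun (y : H) (f : F) => (y : KappaDual 𝕜 F) f}

end EpsProduct

/-! ### Point evaluations -/

section PointEval

variable (𝕜 : Type*) [RCLike 𝕜] {d : ℕ} (k : ℕ∞) {Ω : Opens (EuclideanSpace ℝ (Fin d))}

/-- The point evaluation `δ_x : f ↦ f x`, an element of the dual of `CW^k(Ω) = CW^k(Ω, 𝕜)`. -/
noncomputable def pointEval (x : Ω) : KappaDual 𝕜 (CW 𝕜 k Ω 𝕜) :=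
  UniformConvergenceCLM.ofFun (RingHom.id 𝕜) 𝕜 _
    { toFun := fun f => f x
      map_add' := fun _ _ => rfl
      map_smul' := fun _ _ => rfl
      cont := by
        have h0 : iterPartial (0 : Fin d → ℕ) = (id : (Ω → 𝕜) → Ω → 𝕜) := by
          funext f
          have : ∀ l : List (Fin d),
              l.foldr (fun n g => (partialDer n)^[(0 : Fin d → ℕ) n] g) f = f := by
            intro l
            induction l with
            | nil => rfl
            | cons a l ih => simp
          exact this _
        let β : {β : Fin d → ℕ // ((∑ n, β n : ℕ) : ℕ∞) ≤ k} := ⟨0, by simp⟩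
        have h1 : Continuous (fun f : CW 𝕜 k Ω 𝕜 =>
            UniformOnFun.ofFun {K : Set Ω | IsCompact K} (iterPartial β.1 f)) :=
          continuous_iff_le_induced.2 (iInf_le _ β)
        have h2 := (UniformOnFun.uniformContinuous_eval_of_mem (β := 𝕜) {K : Set Ω | IsCompact K}
          (mem_singleton x) isCompact_singleton).continuous.comp h1
        have h3 : (fun f : CW 𝕜 k Ω 𝕜 => f x) = (fun f : CW 𝕜 k Ω 𝕜 => iterPartial β.1 f x) := by
          funext f
          exact (congrFun (congrFun h0 _) x).symm
        rw [h3]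
        exact h2 }

end PointEval

/-! ### Duality of locally convex spaces -/

section Duality

variable {𝕜 : Type*} [RCLike 𝕜]

/-! Write `F = CW^k(Ω)`. Two facts make `S(u)` a `C^k` function: `x ↦ (f ↦ ∂_w f x)` is continuous
into `F'_κ`, and its difference quotients converge there (`continuous_wordEval`,
`tendsto_wordEvalQuot`). Both hold because the functionals involved are equicontinuous, so that
pointwise convergence is already convergence in `F'_κ`. A continuous linear `u` carries these limits
to `E`. Completeness of `E` plays no role here.

Injectivity and continuity of the inverse rest on the identity `g (u y) = y (g ∘ S u)`. The form `g
∘ u` on `F'_κ` is evaluation at some element of `F` (`KappaDual.exists_eq_eval`, the Mackey–Arens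
argument), and point evaluations identify this element as `g ∘ S u`. Hahn–Banach and polars do the
rest.

For surjectivity, fix `f` and `y ∈ F'`; then `u y` has to represent the form `g ↦ y (g ∘ f)` on
`E'`. Since `y` is controlled by finitely many derivatives on a compact set, this form is dominated
by the supremum of `|g|` over any absolutely convex compact set containing the corresponding values
of the derivatives of `f`. Such a form is evaluation at a point of `E`
(`exists_mem_forall_apply_eq`). The resulting `u` is continuous because `{g ∘ f}`, for `g` in a
polar, is an absolutely convex compact subset of `F`.

Only the existence of these compact sets uses (i) or (ii). Under (i), the continuous image of a
compact subset of `Ω` is metrisable, and metric ccp applies. Under (ii), each derivative is again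
`C¹`, hence locally Lipschitz into a Banach space `E_D` by the mean value theorem; in a Banach space
closed absolutely convex hulls of compact sets are compact, and `E_D` embeds continuously into `E`.
-/

theorem convex_rclike_iff_convex_real {E : Type*} [AddCommGroup E] [Module 𝕜 E] [Module ℝ E]
    [IsScalarTower ℝ 𝕜 E] {s : Set E} : Convex 𝕜 s ↔ Convex ℝ s := by
  constructor
  · intro h x hx y hy a b ha hb hab
    have := h hx hy (a := (a : 𝕜)) (b := (b : 𝕜)) (by exact_mod_cast ha) (by exact_mod_cast hb)
      (by exact_mod_cast hab)
    simpa only [RCLike.real_smul_eq_coe_smul (K := 𝕜)] using this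
  · intro h x hx y hy a b ha hb hab
    obtain ⟨a, ha', rfl⟩ := RCLike.nonneg_iff_exists_ofReal.1 ha
    obtain ⟨b, hb', rfl⟩ := RCLike.nonneg_iff_exists_ofReal.1 hb
    have := h hx hy ha' hb' (by exact_mod_cast hab)
    simpa only [RCLike.real_smul_eq_coe_smul (K := 𝕜)] using this

/-- Multiplying `a` by a suitable unimodular scalar stays in `s` and turns `g a` into `‖g a‖`. -/
theorem Balanced.norm_le_of_forall_re_le {X : Type*} [AddCommGroup X] [Module 𝕜 X] {s : Set X}
    (hs : Balanced 𝕜 s) (g : X →ₗ[𝕜] 𝕜) {u : ℝ} (h : ∀ a ∈ s, RCLike.re (g a) ≤ u) {a : X}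
    (ha : a ∈ s) : ‖g a‖ ≤ u := by
  obtain ⟨c, hc, hca⟩ := RCLike.exists_norm_mul_eq_self (g a)
  by_cases h0 : c = 0
  · simp [h0] at hc
  have h1 : c⁻¹ * g a = (‖g a‖ : 𝕜) := by
    rw [← hca]
    field_simp
    rw [hca]
  have h2 := h (c⁻¹ • a) (hs.smul_mem (by simp [hc]) ha)
  rwa [map_smul, smul_eq_mul, h1, RCLike.ofReal_re] at h2

/-- The bipolar theorem in contrapositive form: separate `v` from `V` and divide by the separating
constant, which is positive because `0 ∈ V`. -/
theorem exists_dual_of_notMem {E : Type*} [AddCommGroup E] [Module 𝕜 E] [Module ℝ E]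
    [IsScalarTower ℝ 𝕜 E] [TopologicalSpace E] [IsTopologicalAddGroup E] [ContinuousSMul 𝕜 E]
    [LocallyConvexSpace ℝ E] {V : Set E} (hV : IsClosed V) (hVc : AbsConvex 𝕜 V)
    (hne : V.Nonempty) {v : E} (hv : v ∉ V) :
    ∃ g : E →L[𝕜] 𝕜, (∀ a ∈ V, ‖g a‖ ≤ 1) ∧ 1 < ‖g v‖ := by
  obtain ⟨f, u, hf, hu⟩ := RCLike.geometric_hahn_banach_closed_point (𝕜 := 𝕜)
    (convex_rclike_iff_convex_real.1 hVc.2) hV hv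
  have h0 : 0 < u := by
    have := hf 0 (hVc.1.zero_mem hne)
    simpa using this
  have hle : ∀ a ∈ V, ‖f a‖ ≤ u := fun a ha =>
    hVc.1.norm_le_of_forall_re_le f.toLinearMap (fun a ha => (hf a ha).le) ha
  refine ⟨((u⁻¹ : ℝ) : 𝕜) • f, fun a ha => ?_, ?_⟩
  · have := hle a ha
    simp only [_root_.smul_apply, norm_smul, RCLike.norm_ofReal, abs_inv,
      abs_of_pos h0]
    rw [inv_mul_le_one₀ h0]
    exact this
  · have := hu.trans_le (RCLike.re_le_norm _)
    simp only [_root_.smul_apply, norm_smul, RCLike.norm_ofReal, abs_inv,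
      abs_of_pos h0]
    rw [lt_inv_mul_iff₀ h0]
    simpa using this

theorem eq_of_forall_dual_eq {E : Type*} [AddCommGroup E] [Module 𝕜 E] [Module ℝ E]
    [IsScalarTower ℝ 𝕜 E] [TopologicalSpace E] [IsTopologicalAddGroup E] [ContinuousSMul 𝕜 E]
    [LocallyConvexSpace ℝ E] [T2Space E] {x y : E} (h : ∀ g : E →L[𝕜] 𝕜, g x = g y) : x = y := by
  by_contra hxy
  obtain ⟨g, hg⟩ := RCLike.geometric_hahn_banach_point_point (𝕜 := 𝕜) hxy
  exact hg.ne (by rw [h g])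

/-- A linear form on a space of continuous functionals that is dominated by the supremum over an
absolutely convex compact set is the evaluation at a point of this set. -/
theorem exists_mem_forall_apply_eq {X : Type*} [AddCommGroup X] [Module 𝕜 X] [TopologicalSpace X]
    {L : Type*} [AddCommGroup L] [Module 𝕜 L] {C : Set X} (hC : IsCompact C)
    (hCc : AbsConvex 𝕜 C) (B : X →ₗ[𝕜] L →ₗ[𝕜] 𝕜) (hB : ∀ l, Continuous fun x => B x l)
    (φ : L →ₗ[𝕜] 𝕜) (hφ : ∀ l M, (∀ x ∈ C, ‖B x l‖ ≤ M) → ‖φ l‖ ≤ M) :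
    ∃ x ∈ C, ∀ l, B x l = φ l := by
  classical
  suffices h : (C ∩ ⋂ l, {x | B x l = φ l}).Nonempty by
    obtain ⟨x, hx, hx'⟩ := h
    exact ⟨x, hx, fun l => mem_iInter.1 hx' l⟩
  -- By compactness of `C`, it suffices to match `φ` on a finite set `s`, which is a problem in
  -- `𝕜^s`.
  refine hC.inter_iInter_nonempty _ (fun l => isClosed_eq (hB l) continuous_const) fun s => ?_
  let T : X →ₗ[𝕜] (s → 𝕜) := LinearMap.pi fun l => B.flip l
  have hT : Continuous T := continuous_pi fun l => hB l
  have hTC : Convex ℝ (T '' C) :=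
    convex_rclike_iff_convex_real.1 (hCc.2.linear_image T)
  by_cases hv : (fun l : s => φ l) ∈ T '' C
  · obtain ⟨x, hx, hx'⟩ := hv
    refine ⟨x, hx, ?_⟩
    simp only [mem_iInter]
    intro l hl
    exact congrFun hx' ⟨l, hl⟩
  · exfalso
    obtain ⟨g, u, hg, hu⟩ := RCLike.geometric_hahn_banach_closed_point (𝕜 := 𝕜) hTC
      (hC.image hT).isClosed hv
    -- A form on `𝕜^s` separating `φ` from `T '' C` is a combination of coordinates, hence comes
    -- from one element `l₀`, at which the domination hypothesis fails.
    let l₀ : L := ∑ l : s, g (Pi.single l 1) • (l : L)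
    have hsum (v : s → 𝕜) : g v = ∑ l : s, g (Pi.single l 1) * v l := by
      conv_lhs => rw [← Finset.univ_sum_single v]
      rw [map_sum]
      refine Finset.sum_congr rfl fun l _ => ?_
      have : (Pi.single l (v l) : s → 𝕜) = v l • Pi.single l 1 := by
        rw [← Pi.single_smul]; simp
      rw [this, map_smul, smul_eq_mul, mul_comm]
    have h1 (x : X) : g (T x) = B x l₀ := by
      rw [hsum, map_sum]
      simp [T]
    have h2 : g (fun l : s => φ l) = φ l₀ := by
      rw [hsum, map_sum]
      simp
    have h3 : ‖φ l₀‖ ≤ u := by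
      refine hφ l₀ u fun x hx => ?_
      refine hCc.1.norm_le_of_forall_re_le (B.flip l₀) (fun a ha => ?_) hx
      have := (hg (T a) (mem_image_of_mem _ ha)).le
      rwa [h1] at this
    rw [h2] at hu
    exact absurd ((RCLike.re_le_norm _).trans h3) (not_le.2 hu)

/-- The polar of a neighbourhood of zero with the topology of pointwise convergence is compact. -/
theorem compactSpace_polar {E : Type*} [AddCommGroup E] [Module 𝕜 E]
    [TopologicalSpace E] [IsTopologicalAddGroup E] [ContinuousSMul 𝕜 E] {V : Set E}
    (hV : V ∈ 𝓝 0) :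
    @CompactSpace {g : E →L[𝕜] 𝕜 // ∀ a ∈ V, ‖g a‖ ≤ 1}
      (TopologicalSpace.induced (fun g => (g.1 : E → 𝕜)) inferInstance) := by
  let P := {g : E →L[𝕜] 𝕜 // ∀ a ∈ V, ‖g a‖ ≤ 1}
  let F : P → (E → 𝕜) := fun g => g.1
  let : TopologicalSpace P := TopologicalSpace.induced F inferInstance
  have hF : IsInducing F := ⟨rfl⟩
  refine ⟨?_⟩
  rw [hF.isCompact_iff, image_univ]
  -- As `V` absorbs every point, the polar lies in a product of closed balls, compact by Tychonoff.
  have habs (a : E) : ∃ r : ℝ, ∀ g : P, ‖g.1 a‖ ≤ r := by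
    have hab : Absorbs 𝕜 V {a} := absorbent_iff_forall_absorbs_singleton.1
      (absorbent_nhds_zero hV) a
    obtain ⟨r, hr, h⟩ := hab.exists_pos
    refine ⟨r, fun g => ?_⟩
    have := h (r : 𝕜) (by simp [abs_of_pos hr])
    obtain ⟨b, hb, hba⟩ := this (mem_singleton a)
    simp only at hba
    rw [← hba, map_smul, norm_smul, RCLike.norm_ofReal, abs_of_pos hr]
    exact mul_le_of_le_one_right hr.le (g.2 b hb)
  choose r hr using habs
  refine (isCompact_univ_pi fun a => isCompact_closedBall (0 : 𝕜) (r a)).of_isClosed_subset ?_ ?_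
  -- Continuity is automatic for a linear form bounded on `V`, so only pointwise closed conditions
  -- remain.
  · have : range F = {g : E → 𝕜 | (∀ a b, g (a + b) = g a + g b) ∧
        (∀ (c : 𝕜) a, g (c • a) = c * g a) ∧ ∀ a ∈ V, ‖g a‖ ≤ 1} := by
      ext g
      constructor
      · rintro ⟨g, rfl⟩
        exact ⟨fun a b => map_add g.1 a b, fun c a => map_smul g.1 c a, g.2⟩
      · rintro ⟨h1, h2, h3⟩
        let g' : E →ₗ[𝕜] 𝕜 := ⟨⟨g, h1⟩, h2⟩
        have hg' : Continuous g' := by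
          refine continuous_of_continuousAt_zero g' ?_
          rw [ContinuousAt, map_zero, Metric.tendsto_nhds]
          intro ε hε
          have hε' : ((ε / 2 : ℝ) : 𝕜) ≠ 0 := by
            exact_mod_cast (half_pos hε).ne'
          filter_upwards [(set_smul_mem_nhds_zero_iff hε').2 hV] with a ha
          obtain ⟨b, hb, rfl⟩ := ha
          rw [dist_zero_right, map_smul, norm_smul, RCLike.norm_ofReal, abs_of_pos (half_pos hε)]
          exact (mul_le_of_le_one_right (half_pos hε).le (h3 b hb)).trans_lt (half_lt_self hε)
        exact ⟨⟨⟨g', hg'⟩, h3⟩, rfl⟩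
    rw [this]
    simp only [Set.ofPred_and, Set.ofPred_forall]
    refine IsClosed.inter ?_ (IsClosed.inter ?_ ?_)
    · exact isClosed_iInter fun a => isClosed_iInter fun b => isClosed_eq (by fun_prop) (by fun_prop)
    · exact isClosed_iInter fun c => isClosed_iInter fun a => isClosed_eq (by fun_prop) (by fun_prop)
    · exact isClosed_iInter fun a => isClosed_iInter fun _ =>
        isClosed_le (by fun_prop) (by fun_prop)
  · rintro _ ⟨g, rfl⟩ a -
    simpa [F] using hr a g

theorem AbsConvex.add {X : Type*} [AddCommGroup X] [Module 𝕜 X] {s t : Set X}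
    (hs : AbsConvex 𝕜 s) (ht : AbsConvex 𝕜 t) : AbsConvex 𝕜 (s + t) :=
  ⟨hs.1.add ht.1, hs.2.add ht.2⟩

/-- `C + D` works when both sets are nonempty, since each then contains `0`. -/
theorem exists_isCompact_absConvex_union {E : Type*} [AddCommGroup E] [Module 𝕜 E]
    [TopologicalSpace E] [IsTopologicalAddGroup E] {C D : Set E} (hC : IsCompact C)
    (hCa : AbsConvex 𝕜 C) (hD : IsCompact D) (hDa : AbsConvex 𝕜 D) :
    ∃ A : Set E, IsCompact A ∧ AbsConvex 𝕜 A ∧ C ⊆ A ∧ D ⊆ A := by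
  rcases C.eq_empty_or_nonempty with rfl | hCn
  · exact ⟨D, hD, hDa, empty_subset _, Subset.rfl⟩
  rcases D.eq_empty_or_nonempty with rfl | hDn
  · exact ⟨C, hC, hCa, Subset.rfl, empty_subset _⟩
  exact ⟨C + D, hC.add hD, hCa.add hDa, fun x hx => ⟨x, hx, 0, hDa.1.zero_mem hDn, add_zero x⟩,
    fun x hx => ⟨0, hCa.1.zero_mem hCn, x, hx, zero_add x⟩⟩

end Duality

/-! ### The dual `F'_κ` -/

section KappaDual

variable {𝕜 : Type*} [RCLike 𝕜] {F : Type*} [AddCommGroup F] [Module 𝕜 F] [TopologicalSpace F]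
  [IsTopologicalAddGroup F]

/-- Under an eventual equicontinuity bound, pointwise convergence is uniform on compact sets: cover
the compact set by finitely many translates of a small neighbourhood and compare at their centres.
-/
theorem KappaDual.tendsto_of_eventually_le {ι : Type*} {l : Filter ι} {T : ι → KappaDual 𝕜 F}
    {y : KappaDual 𝕜 F}
    (hT : ∀ ε > 0, ∃ U ∈ 𝓝 (0 : F), ∀ᶠ i in l, ∀ f ∈ U, ‖T i f‖ ≤ ε)
    (hp : ∀ f, Tendsto (fun i => T i f) l (𝓝 (y f))) : Tendsto T l (𝓝 y) := by
  rw [UniformConvergenceCLM.tendsto_iff_tendstoUniformlyOn]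
  rintro C ⟨-, hC⟩
  rw [Metric.tendstoUniformlyOn_iff]
  intro ε hε
  obtain ⟨U, hU, hTU⟩ := hT (ε / 4) (by positivity)
  have hV : {f | ‖y f‖ < ε / 4} ∈ 𝓝 (0 : F) := by
    have : ContinuousAt (fun f => ‖y f‖) 0 :=
      (ContinuousLinearMap.continuous (y : F →L[𝕜] 𝕜)).norm.continuousAt
    refine this.eventually (gt_mem_nhds ?_)
    simpa using by positivity
  obtain ⟨t, -, ht⟩ := hC.elim_nhds_subcover (fun f₀ => {f | f - f₀ ∈ U ∩ {f | ‖y f‖ < ε / 4}})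
    fun f₀ _ => by
      have : Tendsto (fun f => f - f₀) (𝓝 f₀) (𝓝 0) := by
        have := (show Continuous fun f : F => f - f₀ by fun_prop).tendsto f₀
        rwa [sub_self] at this
      exact this (inter_mem hU hV)
  have h1 : ∀ᶠ i in l, ∀ f₀ ∈ t, dist (T i f₀) (y f₀) < ε / 4 :=
    (eventually_all_finset t).2 fun f₀ _ => (Metric.tendsto_nhds.1 (hp f₀)) _ (by positivity)
  filter_upwards [h1, hTU] with i hi hiU f hf
  obtain ⟨f₀, hf₀, hfU, hfV⟩ : ∃ f₀ ∈ t, f - f₀ ∈ U ∧ ‖y (f - f₀)‖ < ε / 4 := by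
    obtain ⟨f₀, h₀, h⟩ := mem_iUnion₂.1 (ht hf)
    exact ⟨f₀, h₀, h⟩
  have h2 := hi f₀ hf₀
  have h3 := hiU _ hfU
  rw [dist_eq_norm] at h2 ⊢
  have h4 : y f - T i f = y (f - f₀) - T i (f - f₀) - (T i f₀ - y f₀) := by
    simp only [map_sub]; ring
  rw [h4]
  calc _ ≤ ‖y (f - f₀)‖ + ‖T i (f - f₀)‖ + ‖T i f₀ - y f₀‖ :=
        (norm_sub_le _ _).trans (add_le_add_left (norm_sub_le _ _) _)
    _ < ε := by linarith

/-- A continuous linear form on `F'_κ` is the evaluation at an element of `F`. -/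
theorem KappaDual.exists_eq_eval (φ : KappaDual 𝕜 F →L[𝕜] 𝕜) :
    ∃ f : F, ∀ y : KappaDual 𝕜 F, φ y = y f := by
  have hdir : DirectedOn (· ⊆ ·) {K : Set F | AbsConvex 𝕜 K ∧ IsCompact K} := by
    rintro C ⟨hC, hC'⟩ D ⟨hD, hD'⟩
    obtain ⟨A, hA, hAa, hCA, hDA⟩ := exists_isCompact_absConvex_union hC' hC hD' hD
    exact ⟨A, ⟨hAa, hA⟩, hCA, hDA⟩
  have hb := UniformConvergenceCLM.hasBasis_nhds_zero_of_basis (RingHom.id 𝕜) (F := 𝕜)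
    {K : Set F | AbsConvex 𝕜 K ∧ IsCompact K} ⟨∅, AbsConvex.empty, isCompact_empty⟩ hdir
    Metric.nhds_basis_ball
  have hφ : {y | ‖φ y‖ < 1} ∈ 𝓝 (0 : KappaDual 𝕜 F) := by
    have : ContinuousAt (fun y => ‖φ y‖) 0 := φ.continuous.norm.continuousAt
    refine this.eventually (gt_mem_nhds ?_)
    simp
  obtain ⟨C, hne, ε, ⟨hC, hC'⟩, hε, hCε⟩ : ∃ C : Set F, C.Nonempty ∧ ∃ ε : ℝ,
      (AbsConvex 𝕜 C ∧ IsCompact C) ∧ 0 < ε ∧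
      ∀ y : KappaDual 𝕜 F, MapsTo y C (Metric.ball 0 ε) → ‖φ y‖ < 1 := by
    obtain ⟨⟨C, ε⟩, ⟨hC, hε : 0 < ε⟩, hCε⟩ := hb.mem_iff.1 hφ
    rcases C.eq_empty_or_nonempty with rfl | hne
    -- For empty `C` the neighbourhood is everything; `{0}` serves as well and forces `0 ≤ M` below.
    · exact ⟨{0}, singleton_nonempty 0, ε, ⟨⟨balanced_zero, convex_singleton 0⟩,
        isCompact_singleton⟩, hε, fun y _ => hCε fun x hx => absurd hx (notMem_empty x)⟩
    · exact ⟨C, hne, ε, hC, hε, fun y hy => hCε hy⟩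
  -- Rescaling `y` by `‖φ y‖⁻¹` turns the neighbourhood condition into domination by the supremum
  -- over `C`.
  have key : ∀ (y : KappaDual 𝕜 F) (M : ℝ), (∀ x ∈ C, ‖y x‖ ≤ M) → ‖(ε : 𝕜) * φ y‖ ≤ M := by
    intro y M hM
    rw [norm_mul, RCLike.norm_ofReal, abs_of_pos hε]
    by_contra! hlt
    obtain ⟨x₀, hx₀⟩ := hne
    have hpos : 0 < ε * ‖φ y‖ := ((norm_nonneg _).trans (hM x₀ hx₀)).trans_lt hlt
    have hφy : 0 < ‖φ y‖ := (pos_iff_pos_of_mul_pos hpos).1 hε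
    have := hCε (((‖φ y‖⁻¹ : ℝ) : 𝕜) • y) fun f hf => by
      simp only [mem_ball_zero_iff]
      change ‖((‖φ y‖⁻¹ : ℝ) : 𝕜) • y f‖ < ε
      rw [norm_smul, RCLike.norm_ofReal, abs_of_pos (inv_pos.2 hφy), inv_mul_lt_iff₀ hφy, mul_comm]
      exact (hM f hf).trans_lt hlt
    simp only [map_smul, norm_smul, RCLike.norm_ofReal,
      abs_of_pos (inv_pos.2 hφy), inv_mul_cancel₀ hφy.ne', lt_irrefl] at this
  let B : F →ₗ[𝕜] KappaDual 𝕜 F →ₗ[𝕜] 𝕜 :=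
    LinearMap.mk₂ 𝕜 (fun f y => y f) (fun _ _ _ => map_add _ _ _) (fun _ _ _ => map_smul _ _ _)
      (fun _ _ _ => rfl) (fun _ _ _ => rfl)
  obtain ⟨f, -, hf⟩ := exists_mem_forall_apply_eq hC' hC B
    (fun y => ContinuousLinearMap.continuous (y : F →L[𝕜] 𝕜)) ((ε : 𝕜) • φ.toLinearMap)
    (fun y M h => key y M h)
  refine ⟨(ε : 𝕜)⁻¹ • f, fun y => ?_⟩
  have h1 : y f = ε * φ y := hf y
  rw [map_smul, h1, smul_eq_mul, inv_mul_cancel_left₀ (by exact_mod_cast hε.ne')]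

end KappaDual

/-! ### Iterated partial derivatives along words -/

section Words

variable {E : Type*} [AddCommGroup E] [Module ℝ E] {d : ℕ}
  {Ω : Opens (EuclideanSpace ℝ (Fin d))} [TopologicalSpace E]

/-- The iterated partial derivative `∂_{w₁} ⋯ ∂_{wₘ} f` along a word `w = w₁ ⋯ wₘ`. -/
noncomputable def wordDer (w : List (Fin d)) (f : Ω → E) : Ω → E :=
  w.foldr partialDer f

@[simp]
theorem wordDer_cons (n : Fin d) (w : List (Fin d)) (f : Ω → E) :
    wordDer (n :: w) f = partialDer n (wordDer w f) := rfl

theorem wordDer_append (v w : List (Fin d)) (f : Ω → E) :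
    wordDer (v ++ w) f = wordDer v (wordDer w f) := by
  simp [wordDer]

theorem wordDer_replicate (m : ℕ) (n : Fin d) (f : Ω → E) :
    wordDer (List.replicate m n) f = (partialDer n)^[m] f := by
  induction m with
  | zero => rfl
  | succ m ih => rw [List.replicate_succ, wordDer_cons, ih, Function.iterate_succ_apply']

/-- The word with `β n` letters `n`, in increasing order. -/
def multiIndexWord (β : Fin d → ℕ) : List (Fin d) :=
  (List.finRange d).flatMap fun n => List.replicate (β n) n

theorem iterPartial_eq_wordDer (β : Fin d → ℕ) (f : Ω → E) :
    iterPartial β f = wordDer (multiIndexWord β) f := by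
  unfold iterPartial multiIndexWord
  induction List.finRange d with
  | nil => rfl
  | cons n l ih =>
    rw [List.foldr_cons, ih, List.flatMap_cons, wordDer_append, wordDer_replicate]

theorem length_multiIndexWord (β : Fin d → ℕ) : (multiIndexWord β).length = ∑ n, β n := by
  simp [multiIndexWord, List.length_flatMap, ← List.ofFn_eq_map, List.sum_ofFn]

theorem count_multiIndexWord (β : Fin d → ℕ) (n : Fin d) :
    (multiIndexWord β).count n = β n := by
  rw [multiIndexWord, List.count_flatMap]
  have : (List.count n ∘ fun n => List.replicate (β n) n) = fun m => if m = n then β n else 0 := by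
    funext m
    by_cases h : m = n
    · subst h; simp
    · simp [List.count_replicate, h]
  rw [this, ← List.ofFn_eq_map, List.sum_ofFn]
  simp

theorem sum_count_eq_length (w : List (Fin d)) : ∑ n, w.count n = w.length := by
  simpa using Multiset.sum_count_eq_card (s := Finset.univ) (m := (w : Multiset (Fin d)))
    (fun a _ => Finset.mem_univ a)

/-- The topology of `CW^k` only mentions derivatives along sorted words; this is the combinatorial
half of the reduction to them, `wordDer_perm` the analytic half. -/
theorem perm_multiIndexWord (w : List (Fin d)) : w.Perm (multiIndexWord fun n => w.count n) := by
  rw [List.perm_iff_count]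
  intro n
  rw [count_multiIndexWord]

/-- Continuity of `f` is a separate hypothesis because `IsC (m + 1)` only speaks of its derivatives.
-/
theorem IsC.of_succ {m : ℕ} {f : Ω → E} (h : IsC (m + 1) f) (hc : Continuous f) : IsC m f := by
  induction m generalizing f with
  | zero => exact hc
  | succ m ih => exact ⟨h.1, fun n => ih (h.2 n) (h.1 n).2⟩

theorem IsC.wordDer {w : List (Fin d)} {m : ℕ} {f : Ω → E} (h : IsC (m + w.length) f)
    (hc : Continuous f) : IsC m (wordDer w f) ∧ Continuous (_root_.wordDer w f) := by
  induction w generalizing m with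
  | nil => exact ⟨h, hc⟩
  | cons n w ih =>
    have := (ih (m := m + 1) (by rw [List.length_cons] at h; convert h using 1; ring)).1
    exact ⟨this.2 n, (this.1 n).2⟩

theorem isC_of_wordDer {m : ℕ} {f : Ω → E}
    (hc : ∀ w : List (Fin d), w.length ≤ m → Continuous (wordDer w f))
    (hp : ∀ w : List (Fin d), w.length < m → ∀ n, HasPartial n (wordDer w f)) : IsC m f := by
  induction m generalizing f with
  | zero => exact hc [] le_rfl
  | succ m ih =>
    refine ⟨fun n => ⟨hp [] (by simp) n, hc [n] (by simp)⟩, fun n => ih ?_ ?_⟩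
    · intro w hw
      -- `IsC` peels off the innermost derivative, which is the last letter of a word.
      have := hc (w ++ [n]) (by simpa using hw)
      rwa [wordDer_append] at this
    · intro w hw i
      have := hp (w ++ [n]) (by simpa using hw) i
      rwa [wordDer_append] at this

end Words

/-! ### Derivatives and continuous linear maps -/

section Comp

variable {𝕜 : Type*} [RCLike 𝕜] {E E' : Type*} [AddCommGroup E] [Module ℝ E] [Module 𝕜 E]
  [IsScalarTower ℝ 𝕜 E] [TopologicalSpace E]
  [AddCommGroup E'] [Module ℝ E'] [Module 𝕜 E'] [IsScalarTower ℝ 𝕜 E'] [TopologicalSpace E']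
  [T2Space E'] {d : ℕ} {Ω : Opens (EuclideanSpace ℝ (Fin d))}

omit [T2Space E'] in
theorem diffQuot_comp (g : E →L[𝕜] E') (n : Fin d) (f : Ω → E) (x : Ω) :
    diffQuot n (g ∘ f) x = g ∘ diffQuot n f x := by
  funext h
  have : Function.extend Subtype.val (g ∘ f) (0 : EuclideanSpace ℝ (Fin d) → E') =
      g ∘ Function.extend Subtype.val f 0 := by
    funext y
    by_cases hy : ∃ a : Ω, (a : EuclideanSpace ℝ (Fin d)) = y
    · obtain ⟨a, rfl⟩ := hy
      simp
    · simp [Function.extend_apply' _ _ _ hy]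
  simp only [diffQuot, this, Function.comp_apply]
  rw [← map_sub, ← ContinuousLinearMap.coe_coe g, LinearMap.map_smul_of_tower]

omit [T2Space E'] in
theorem HasPartial.tendsto_comp {n : Fin d} {f : Ω → E} (hf : HasPartial n f) (g : E →L[𝕜] E')
    (x : Ω) : Tendsto (diffQuot n (g ∘ f) x) (𝓝[≠] 0) (𝓝 (g (partialDer n f x))) := by
  rw [diffQuot_comp]
  exact (g.continuous.tendsto _).comp (hf.tendsto x)

omit [T2Space E'] in
theorem HasPartial.comp {n : Fin d} {f : Ω → E} (hf : HasPartial n f) (g : E →L[𝕜] E') :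
    HasPartial n (g ∘ f) :=
  fun x => ⟨_, hf.tendsto_comp g x⟩

theorem HasPartial.partialDer_comp {n : Fin d} {f : Ω → E} (hf : HasPartial n f)
    (g : E →L[𝕜] E') : partialDer n (g ∘ f) = g ∘ partialDer n f :=
  funext fun x => partialDer_eq (hf.tendsto_comp g x)

theorem IsC.comp {m : ℕ} {f : Ω → E} (hf : IsC m f) (g : E →L[𝕜] E') : IsC m (g ∘ f) := by
  induction m generalizing f with
  | zero => exact g.continuous.comp hf
  | succ m ih =>
    refine ⟨fun n => ⟨(hf.1 n).1.comp g, ?_⟩, fun n => ?_⟩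
    · rw [(hf.1 n).1.partialDer_comp]
      exact g.continuous.comp (hf.1 n).2
    · rw [(hf.1 n).1.partialDer_comp]
      exact ih (hf.2 n)

theorem IsC.wordDer_comp {w : List (Fin d)} {f : Ω → E} (hf : IsC w.length f)
    (hc : Continuous f) (g : E →L[𝕜] E') : _root_.wordDer w (g ∘ f) = g ∘ _root_.wordDer w f := by
  induction w with
  | nil => rfl
  | cons n w ih =>
    have h : IsC (1 + w.length) f := by
      rw [List.length_cons] at hf
      rwa [add_comm]
    rw [wordDer_cons, ih (IsC.of_succ hf hc),
      ((IsC.wordDer h hc).1.1 n).1.partialDer_comp, wordDer_cons]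

end Comp

/-! ### Scalar-valued functions -/

section Scalar

variable {𝕜 : Type*} [RCLike 𝕜] {d : ℕ} {Ω : Opens (EuclideanSpace ℝ (Fin d))}

/-- The extension of a function on `Ω` by zero. -/
noncomputable def extendZero (f : Ω → 𝕜) : EuclideanSpace ℝ (Fin d) → 𝕜 :=
  Function.extend Subtype.val f 0

theorem extendZero_apply (f : Ω → 𝕜) (x : Ω) : extendZero f x = f x :=
  Subtype.val_injective.extend_apply _ _ _

theorem extendZero_of_mem (f : Ω → 𝕜) {x : EuclideanSpace ℝ (Fin d)} (hx : x ∈ Ω) :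
    extendZero f x = f ⟨x, hx⟩ :=
  extendZero_apply f ⟨x, hx⟩

theorem continuousOn_extendZero {f : Ω → 𝕜} (hf : Continuous f) :
    ContinuousOn (extendZero f) Ω := by
  rw [continuousOn_iff_continuous_domRestrict]
  exact hf.congr fun x => (extendZero_apply f x).symm

theorem HasPartial.hasDerivAt {n : Fin d} {f : Ω → 𝕜} (hf : HasPartial n f)
    {x : EuclideanSpace ℝ (Fin d)} {t : ℝ} (hx : x + t • EuclideanSpace.single n (1 : ℝ) ∈ Ω) :
    HasDerivAt (fun s : ℝ => extendZero f (x + s • EuclideanSpace.single n (1 : ℝ)))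
      (extendZero (partialDer n f) (x + t • EuclideanSpace.single n (1 : ℝ))) t := by
  rw [hasDerivAt_iff_tendsto_slope_zero, extendZero_of_mem (partialDer n f) hx]
  refine (hf.tendsto ⟨_, hx⟩).congr fun h => ?_
  rw [diffQuot, extendZero_of_mem f hx, add_smul, ← add_assoc]
  rfl

/-- The mean value inequality along a coordinate direction. -/
theorem HasPartial.norm_sub_sub_le {n : Fin d} {f : Ω → 𝕜} (hf : HasPartial n f)
    {x : EuclideanSpace ℝ (Fin d)} {h : ℝ} {c : 𝕜} {ε : ℝ}
    (hx : ∀ t ∈ uIcc 0 h, ∃ hy : x + t • EuclideanSpace.single n (1 : ℝ) ∈ Ω,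
      ‖partialDer n f ⟨_, hy⟩ - c‖ ≤ ε) :
    ‖extendZero f (x + h • EuclideanSpace.single n (1 : ℝ)) - extendZero f x - h • c‖ ≤
      ε * |h| := by
  have hd : ∀ t ∈ uIcc 0 h, HasDerivWithinAt
      (fun s : ℝ => extendZero f (x + s • EuclideanSpace.single n (1 : ℝ)) - s • c)
      (extendZero (partialDer n f) (x + t • EuclideanSpace.single n (1 : ℝ)) - c)
      (uIcc 0 h) t := by
    intro t ht
    obtain ⟨hy, -⟩ := hx t ht
    have h1 := (hf.hasDerivAt hy).sub ((hasDerivAt_id t).smul_const c)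
    simp only [one_smul] at h1
    exact h1.hasDerivWithinAt
  have := (convex_uIcc 0 h).norm_image_sub_le_of_norm_hasDerivWithin_le hd (C := ε)
    (fun t ht => by
      obtain ⟨hy, h2⟩ := hx t ht
      rwa [extendZero_of_mem _ hy]) left_mem_uIcc right_mem_uIcc
  simp only [zero_smul, add_zero, sub_zero, Real.norm_eq_abs] at this
  rwa [sub_right_comm]

/-- The mean value inequality on a box. -/
theorem norm_sub_sub_sum_le {f : Ω → 𝕜} (hf : ∀ n, HasPartial n f)
    {y z : EuclideanSpace ℝ (Fin d)} {c : Fin d → 𝕜} {ε : ℝ}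
    (hbox : ∀ p : EuclideanSpace ℝ (Fin d), (∀ i, p i ∈ uIcc (y i) (z i)) →
      ∃ hp : p ∈ Ω, ∀ n, ‖partialDer n f ⟨p, hp⟩ - c n‖ ≤ ε) :
    ‖extendZero f z - extendZero f y - ∑ i, (z i - y i) • c i‖ ≤ ε * ∑ i, |z i - y i| := by
  classical
  -- Pass from `y` to `z` one coordinate at a time; at `p s` the coordinates in `s` have been
  -- changed. All segments stay in the box.
  let p (s : Finset (Fin d)) : EuclideanSpace ℝ (Fin d) :=
    WithLp.toLp 2 fun i => if i ∈ s then z i else y i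
  have hp (s) (i) : p s i = if i ∈ s then z i else y i := rfl
  have key : ∀ s : Finset (Fin d), ‖extendZero f (p s) - extendZero f y -
      ∑ i ∈ s, (z i - y i) • c i‖ ≤ ε * ∑ i ∈ s, |z i - y i| := by
    intro s
    induction s using Finset.induction_on with
    | empty =>
      have : p ∅ = y := by ext i; simp [hp]
      simp [this]
    | insert a s ha ih =>
      have h1 : p (insert a s) = p s + (z a - y a) • EuclideanSpace.single a (1 : ℝ) := by
        ext i
        by_cases hi : i = a
        · subst hi; simp [hp, ha]
        · simp [hp, hi]
      have h2 := (hf a).norm_sub_sub_le (x := p s) (h := z a - y a) (c := c a) (ε := ε) (by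
        intro t ht
        obtain ⟨h3, h4⟩ := hbox (p s + t • EuclideanSpace.single a (1 : ℝ)) (by
          intro i
          by_cases hi : i = a
          · subst hi
            have : y i + t ∈ uIcc (y i) (z i) := by
              rw [mem_uIcc] at ht ⊢
              rcases ht with h | h
              · exact .inl ⟨by linarith, by linarith⟩
              · exact .inr ⟨by linarith, by linarith⟩
            simpa [hp, ha] using this
          · by_cases his : i ∈ s <;> simp [hp, hi, his])
        exact ⟨h3, h4 a⟩)
      rw [Finset.sum_insert ha, Finset.sum_insert ha, h1, mul_add]
      refine le_trans (le_of_eq ?_) ((norm_add_le _ _).trans (add_le_add h2 ih))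
      congr 1
      abel
  have huniv : p Finset.univ = z := by ext i; simp [hp]
  simpa [huniv] using key Finset.univ

theorem abs_apply_sub_le (x y : EuclideanSpace ℝ (Fin d)) (i : Fin d) :
    |y i - x i| ≤ dist y x := by
  rw [dist_eq_norm]
  exact PiLp.norm_apply_le (y - x) i

/-- The box spanned by two points near `x` stays near `x`. -/
theorem dist_le_of_mem_box {x y z p : EuclideanSpace ℝ (Fin d)} {r : ℝ}
    (hy : dist y x ≤ r) (hz : dist z x ≤ r) (hp : ∀ i, p i ∈ uIcc (y i) (z i)) :
    dist p x ≤ (d + 1) * r := by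
  have hr : 0 ≤ r := dist_nonneg.trans hy
  have h1 : ∀ i, |p i - x i| ≤ r := fun i => by
    have hyi := abs_le.1 ((abs_apply_sub_le x y i).trans hy)
    have hzi := abs_le.1 ((abs_apply_sub_le x z i).trans hz)
    have := hp i
    rw [mem_uIcc] at this
    rw [abs_le]
    rcases this with h | h <;> constructor <;> linarith
  calc dist p x ≤ ∑ i, |p i - x i| := by
        rw [EuclideanSpace.dist_eq]
        refine Real.sqrt_le_iff.2 ⟨Finset.sum_nonneg fun i _ => abs_nonneg _, ?_⟩
        simp only [Real.dist_eq]
        exact Finset.sum_sq_le_sq_sum_of_nonneg fun i _ => abs_nonneg _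
    _ ≤ ∑ _i : Fin d, r := Finset.sum_le_sum fun i _ => h1 i
    _ = d * r := by simp
    _ ≤ (d + 1) * r := by nlinarith

/-- The linear map `v ↦ ∑ i, v i • c i`. -/
noncomputable def gradLin (c : Fin d → 𝕜) : EuclideanSpace ℝ (Fin d) →L[ℝ] 𝕜 :=
  ∑ i, (EuclideanSpace.proj i : EuclideanSpace ℝ (Fin d) →L[ℝ] ℝ).smulRight (c i)

theorem gradLin_apply (c : Fin d → 𝕜) (v : EuclideanSpace ℝ (Fin d)) :
    gradLin c v = ∑ i, v i • c i := by
  simp [gradLin]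

/-- A function with continuous partial derivatives is differentiable. -/
theorem hasFDerivAt_extendZero {f : Ω → 𝕜} (hf : ∀ n, HasPartial n f)
    (hc : ∀ n, Continuous (partialDer n f)) {x : EuclideanSpace ℝ (Fin d)} (hx : x ∈ Ω) :
    HasFDerivAt (extendZero f) (gradLin fun n => extendZero (partialDer n f) x) x := by
  refine HasFDerivAt.of_isLittleO (Asymptotics.isLittleO_iff.2 fun ε hε => ?_)
  -- The factor `d + 1` absorbs the sum over coordinates, and is nonzero also for `d = 0`.
  have h1 : ∀ᶠ p in 𝓝 x, p ∈ Ω ∧ ∀ n, ‖extendZero (partialDer n f) p -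
      extendZero (partialDer n f) x‖ ≤ ε / (d + 1) := by
    refine Filter.Eventually.and (Ω.isOpen.mem_nhds hx) (eventually_all.2 fun n => ?_)
    have h2 := (continuousOn_extendZero (hc n)).continuousAt (Ω.isOpen.mem_nhds hx)
    filter_upwards [Metric.tendsto_nhds.1 h2 (ε / (d + 1)) (by positivity)] with p hp
    rw [← dist_eq_norm]
    exact hp.le
  obtain ⟨r, hr, hball⟩ := Metric.eventually_nhds_iff.1 h1
  have h3 : ∀ᶠ y in 𝓝 x, dist y x < r / (d + 1) := Metric.ball_mem_nhds x (by positivity)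
  filter_upwards [h3] with y hy
  have h4 := norm_sub_sub_sum_le hf (y := x) (z := y) (c := fun n => extendZero (partialDer n f) x)
    (ε := ε / (d + 1)) (fun p hp => by
      have h5 : dist p x < r := by
        have := dist_le_of_mem_box (by rw [dist_self]; exact dist_nonneg) le_rfl hp
        refine this.trans_lt ?_
        rw [lt_div_iff₀ (by positivity)] at hy
        linarith
      obtain ⟨hpΩ, h6⟩ := hball h5
      refine ⟨hpΩ, fun n => ?_⟩
      have := h6 n
      rwa [extendZero_of_mem _ hpΩ] at this)
  rw [gradLin_apply]
  refine h4.trans ?_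
  have h5 : ∑ i, |y i - x i| ≤ (d + 1) * ‖y - x‖ := by
    calc ∑ i, |y i - x i| ≤ ∑ _i : Fin d, dist y x :=
          Finset.sum_le_sum fun i _ => abs_apply_sub_le x y i
      _ = d * ‖y - x‖ := by simp [dist_eq_norm]
      _ ≤ (d + 1) * ‖y - x‖ := by nlinarith [norm_nonneg (y - x)]
  calc ε / (d + 1) * ∑ i, |y i - x i| ≤ ε / (d + 1) * ((d + 1) * ‖y - x‖) := by gcongr
    _ = ε * ‖y - x‖ := by field_simp

/-- Schwarz's theorem: `f` and its first partial derivatives have continuous partial derivatives,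
hence are Fréchet differentiable, and the second Fréchet derivative is symmetric. -/
theorem partialDer_comm {f : Ω → 𝕜} (hf : IsC 2 f) (a b : Fin d) :
    partialDer a (partialDer b f) = partialDer b (partialDer a f) := by
  funext x
  let f' (y : EuclideanSpace ℝ (Fin d)) : EuclideanSpace ℝ (Fin d) →L[ℝ] 𝕜 :=
    gradLin fun n => extendZero (partialDer n f) y
  have h1 : ∀ᶠ y in 𝓝 (x : EuclideanSpace ℝ (Fin d)), HasFDerivAt (extendZero f) (f' y) y := by
    filter_upwards [Ω.isOpen.mem_nhds x.2] with y hy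
    exact hasFDerivAt_extendZero (fun n => (hf.1 n).1) (fun n => (hf.1 n).2) hy
  have h2 (n : Fin d) := hasFDerivAt_extendZero (fun m => ((hf.2 n).1 m).1)
    (fun m => ((hf.2 n).1 m).2) x.2
  let f'' : EuclideanSpace ℝ (Fin d) →L[ℝ] EuclideanSpace ℝ (Fin d) →L[ℝ] 𝕜 :=
    ∑ n, (ContinuousLinearMap.smulRightL ℝ (EuclideanSpace ℝ (Fin d)) 𝕜
      (EuclideanSpace.proj n : EuclideanSpace ℝ (Fin d) →L[ℝ] ℝ)).comp
      (gradLin fun m => extendZero (partialDer m (partialDer n f)) x)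
  have h3 : HasFDerivAt f' f'' x := by
    refine HasFDerivAt.fun_sum fun n _ => ?_
    exact (ContinuousLinearMap.hasFDerivAt (ContinuousLinearMap.smulRightL ℝ
      (EuclideanSpace ℝ (Fin d)) 𝕜 (EuclideanSpace.proj n))).comp
      (x : EuclideanSpace ℝ (Fin d)) (h2 n)
  have h4 (m n : Fin d) : f'' (EuclideanSpace.single m 1) (EuclideanSpace.single n 1) =
      partialDer m (partialDer n f) x := by
    simp [f'', gradLin_apply, extendZero_apply]
  rw [← h4, ← h4]
  exact second_derivative_symmetric_of_eventually h1 h3 _ _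

theorem wordDer_perm {v w : List (Fin d)} (h : v.Perm w) {f : Ω → 𝕜} (hc : Continuous f)
    (hf : IsC v.length f) : wordDer v f = wordDer w f := by
  induction h with
  | nil => rfl
  | cons n h ih => rw [wordDer_cons, wordDer_cons, ih (IsC.of_succ hf hc)]
  | swap a b l =>
    have : IsC (2 + l.length) f := by
      convert hf using 1
      simp only [List.length_cons]
      ring
    simp only [wordDer_cons]
    exact partialDer_comm (IsC.wordDer this hc).1 _ _
  | trans h _ ih₁ ih₂ => rw [ih₁ hf, ih₂ (by rwa [← h.length_eq])]

end Scalar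

/-! ### The topology of `CW^k(Ω, E)` -/

section CWTopology

variable {𝕜 : Type*} [RCLike 𝕜] {d : ℕ} {k : ℕ∞} {Ω : Opens (EuclideanSpace ℝ (Fin d))}
  {E : Type*} [AddCommGroup E] [Module 𝕜 E] [Module ℝ E] [IsScalarTower ℝ 𝕜 E]
  [UniformSpace E] [IsUniformAddGroup E] [ContinuousSMul 𝕜 E] [T2Space E]

namespace CW

theorem isC (f : CW 𝕜 k Ω E) {m : ℕ} (hm : (m : ℕ∞) ≤ k) : IsC m (f : Ω → E) := f.2 m hm

theorem continuous_coe (f : CW 𝕜 k Ω E) : Continuous (f : Ω → E) := f.2 0 (by simp)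

theorem isC_wordDer (f : CW 𝕜 k Ω E) {w : List (Fin d)} {m : ℕ}
    (hm : ((m + w.length : ℕ) : ℕ∞) ≤ k) : IsC m (wordDer w (f : Ω → E)) :=
  (IsC.wordDer (f.isC hm) f.continuous_coe).1

theorem continuous_wordDer (f : CW 𝕜 k Ω E) {w : List (Fin d)} (hw : (w.length : ℕ∞) ≤ k) :
    Continuous (wordDer w (f : Ω → E)) :=
  f.isC_wordDer (m := 0) (by simpa using hw)

theorem hasPartial_wordDer (f : CW 𝕜 k Ω E) {n : Fin d} {w : List (Fin d)}
    (hw : ((n :: w).length : ℕ∞) ≤ k) : HasPartial n (wordDer w (f : Ω → E)) :=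
  ((f.isC_wordDer (m := 1) (by rwa [add_comm])).1 n).1

theorem length_le_of_cons {α : Type*} {n : α} {w : List α}
    (hw : ((n :: w).length : ℕ∞) ≤ k) : (w.length : ℕ∞) ≤ k :=
  le_trans (by exact_mod_cast Nat.le_succ _) hw

theorem length_multiIndexWord_le {β : Fin d → ℕ} (hβ : ((∑ n, β n : ℕ) : ℕ∞) ≤ k) :
    ((multiIndexWord β).length : ℕ∞) ≤ k := by
  rwa [length_multiIndexWord]

theorem continuous_iterPartial (f : CW 𝕜 k Ω E) {β : Fin d → ℕ}
    (hβ : ((∑ n, β n : ℕ) : ℕ∞) ≤ k) : Continuous (iterPartial β (f : Ω → E)) := by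
  rw [iterPartial_eq_wordDer]
  exact f.continuous_wordDer (length_multiIndexWord_le hβ)

theorem wordDer_add (f g : CW 𝕜 k Ω E) {w : List (Fin d)} (hw : (w.length : ℕ∞) ≤ k) :
    wordDer w ((f + g : CW 𝕜 k Ω E) : Ω → E) = wordDer w (f : Ω → E) + wordDer w (g : Ω → E) := by
  induction w with
  | nil => rfl
  | cons n w ih =>
    rw [wordDer_cons, ih (length_le_of_cons hw)]
    exact funext fun x => partialDer_eq
      (tendsto_diffQuot_add (f.hasPartial_wordDer hw) (g.hasPartial_wordDer hw) x)

theorem wordDer_smul (c : 𝕜) (f : CW 𝕜 k Ω E) {w : List (Fin d)} (hw : (w.length : ℕ∞) ≤ k) :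
    wordDer w ((c • f : CW 𝕜 k Ω E) : Ω → E) = c • wordDer w (f : Ω → E) := by
  induction w with
  | nil => rfl
  | cons n w ih =>
    rw [wordDer_cons, ih (length_le_of_cons hw)]
    exact funext fun x => partialDer_eq (tendsto_diffQuot_smul c (f.hasPartial_wordDer hw) x)

theorem iterPartial_add (f g : CW 𝕜 k Ω E) {β : Fin d → ℕ} (hβ : ((∑ n, β n : ℕ) : ℕ∞) ≤ k) :
    iterPartial β ((f + g : CW 𝕜 k Ω E) : Ω → E) =
      iterPartial β (f : Ω → E) + iterPartial β (g : Ω → E) := by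
  simp only [iterPartial_eq_wordDer]
  exact wordDer_add f g (length_multiIndexWord_le hβ)

/-- The partial derivative of order `β` as a homomorphism. -/
noncomputable def iterPartialHom (β : {β : Fin d → ℕ // ((∑ n, β n : ℕ) : ℕ∞) ≤ k}) :
    CW 𝕜 k Ω E →+ (Ω →ᵤ[{K : Set Ω | IsCompact K}] E) :=
  AddMonoidHom.mk' (fun f => UniformOnFun.ofFun {K : Set Ω | IsCompact K} (iterPartial β.1 f))
    fun f g => congrArg (UniformOnFun.ofFun _) (iterPartial_add f g β.2)

instance : IsTopologicalAddGroup (CW 𝕜 k Ω E) :=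
  topologicalAddGroup_iInf fun β => topologicalAddGroup_induced (iterPartialHom (𝕜 := 𝕜) β)

theorem nhds_zero_eq : 𝓝 (0 : CW 𝕜 k Ω E) =
    ⨅ β : {β : Fin d → ℕ // ((∑ n, β n : ℕ) : ℕ∞) ≤ k},
      comap (iterPartialHom (𝕜 := 𝕜) (Ω := Ω) (E := E) β) (𝓝 0) := by
  have : 𝓝 (0 : CW 𝕜 k Ω E) = _ := nhds_iInf (a := (0 : CW 𝕜 k Ω E))
    (t := fun β => TopologicalSpace.induced (iterPartialHom (𝕜 := 𝕜) β) inferInstance)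
  rw [this]
  refine iInf_congr fun β => ?_
  rw [nhds_induced, map_zero]

omit [Module ℝ E] [T2Space E] in
theorem hasBasis_nhds_zero_uniformOnFun :
    (𝓝 (0 : Ω →ᵤ[{K : Set Ω | IsCompact K}] E)).HasBasis
      (fun KV : Set Ω × Set E => IsCompact KV.1 ∧ KV.2 ∈ 𝓝 0)
      fun KV => {f | ∀ x ∈ KV.1, UniformOnFun.toFun _ f x ∈ KV.2} :=
  UniformOnFun.hasBasis_nhds_zero {K : Set Ω | IsCompact K} ⟨∅, isCompact_empty⟩
    (directedOn_of_sup_mem fun _ _ h₁ h₂ => h₁.union h₂)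

theorem eventually_iterPartial_mem {β : Fin d → ℕ} (hβ : ((∑ n, β n : ℕ) : ℕ∞) ≤ k) {K : Set Ω}
    (hK : IsCompact K) {V : Set E} (hV : V ∈ 𝓝 0) :
    ∀ᶠ f : CW 𝕜 k Ω E in 𝓝 0, ∀ x ∈ K, iterPartial β (f : Ω → E) x ∈ V := by
  rw [nhds_zero_eq]
  refine mem_iInf_of_mem ⟨β, hβ⟩ ?_
  exact ⟨_, hasBasis_nhds_zero_uniformOnFun.mem_of_mem (i := (K, V)) ⟨hK, hV⟩, fun f hf => hf⟩

theorem exists_of_mem_nhds_zero {U : Set (CW 𝕜 k Ω E)} (hU : U ∈ 𝓝 0) :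
    ∃ (K : Set Ω) (s : Set {β : Fin d → ℕ // ((∑ n, β n : ℕ) : ℕ∞) ≤ k}) (V : Set E),
      IsCompact K ∧ s.Finite ∧ V ∈ 𝓝 0 ∧
      ∀ f : CW 𝕜 k Ω E, (∀ β ∈ s, ∀ x ∈ K, iterPartial β.1 (f : Ω → E) x ∈ V) → f ∈ U := by
  rw [nhds_zero_eq, mem_iInf] at hU
  obtain ⟨s, hs, W, hW, rfl⟩ := hU
  have h (β : s) : ∃ (K : Set Ω) (V : Set E), IsCompact K ∧ V ∈ 𝓝 0 ∧
      ∀ f : CW 𝕜 k Ω E, (∀ x ∈ K, iterPartial β.1.1 (f : Ω → E) x ∈ V) → f ∈ W β := by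
    obtain ⟨T, hT, hTW⟩ := hW β
    obtain ⟨⟨K, V⟩, ⟨hK, hV⟩, hKV⟩ := hasBasis_nhds_zero_uniformOnFun.mem_iff.1 hT
    exact ⟨K, V, hK, hV, fun f hf => hTW (hKV hf)⟩
  choose K V hK hV hKV using h
  have := hs.to_subtype
  refine ⟨⋃ β, K β, s, ⋂ β, V β, isCompact_iUnion hK, hs, iInter_mem.2 hV, fun f hf => ?_⟩
  refine mem_iInter.2 fun β => hKV β f fun x hx => ?_
  exact mem_iInter.1 (hf β.1 β.2 x (mem_iUnion_of_mem β hx)) β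

theorem wordDer_eq_iterPartial (f : CW 𝕜 k Ω 𝕜) {w : List (Fin d)} (hw : (w.length : ℕ∞) ≤ k) :
    wordDer w (f : Ω → 𝕜) = iterPartial (fun n => w.count n) (f : Ω → 𝕜) := by
  rw [iterPartial_eq_wordDer]
  exact wordDer_perm (perm_multiIndexWord w) f.continuous_coe (f.isC hw)

/-- By Schwarz's theorem, derivatives taken in any order are controlled by the topology. -/
theorem eventually_norm_wordDer_le {w : List (Fin d)} (hw : (w.length : ℕ∞) ≤ k) {K : Set Ω}
    (hK : IsCompact K) {ε : ℝ} (hε : 0 < ε) :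
    ∀ᶠ f : CW 𝕜 k Ω 𝕜 in 𝓝 0, ∀ x ∈ K, ‖wordDer w (f : Ω → 𝕜) x‖ ≤ ε := by
  have hβ : ((∑ n, w.count n : ℕ) : ℕ∞) ≤ k := by rwa [sum_count_eq_length]
  filter_upwards [eventually_iterPartial_mem hβ hK (Metric.closedBall_mem_nhds (0 : 𝕜) hε)]
    with f hf x hx
  rw [wordDer_eq_iterPartial f hw]
  simpa using hf x hx

end CW

/-! ### Evaluation of derivatives -/

/-- The functional `f ↦ ∂_w f x` on `CW^k(Ω)`. -/
noncomputable def wordEval (𝕜 : Type*) [RCLike 𝕜] (k : ℕ∞) (w : List (Fin d))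
    (hw : (w.length : ℕ∞) ≤ k) (x : Ω) : KappaDual 𝕜 (CW 𝕜 k Ω 𝕜) :=
  UniformConvergenceCLM.ofFun (RingHom.id 𝕜) 𝕜 _
    { toFun := fun f => wordDer w (f : Ω → 𝕜) x
      map_add' := fun f g => congrFun (CW.wordDer_add f g hw) x
      map_smul' := fun c f => congrFun (CW.wordDer_smul c f hw) x
      cont := by
        let φ : CW 𝕜 k Ω 𝕜 →+ 𝕜 := AddMonoidHom.mk' (fun f => wordDer w (f : Ω → 𝕜) x)
          fun f g => congrFun (CW.wordDer_add f g hw) x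
        refine continuous_of_continuousAt_zero φ ?_
        rw [ContinuousAt, map_zero, Metric.nhds_basis_closedBall.tendsto_right_iff]
        intro ε hε
        filter_upwards [CW.eventually_norm_wordDer_le hw (isCompact_singleton (x := x)) hε]
          with f hf
        exact mem_closedBall_zero_iff.2 (hf x rfl) }

theorem continuous_wordEval (w : List (Fin d)) (hw : (w.length : ℕ∞) ≤ k) :
    Continuous (wordEval 𝕜 k (Ω := Ω) w hw) := by
  rw [continuous_iff_continuousAt]
  intro x
  refine KappaDual.tendsto_of_eventually_le (fun ε hε => ?_) fun f =>
    (f.continuous_wordDer hw).tendsto x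
  have : LocallyCompactSpace Ω := Ω.isOpen.locallyCompactSpace
  obtain ⟨K, hK, hxK⟩ := exists_compact_mem_nhds x
  refine ⟨_, CW.eventually_norm_wordDer_le hw hK hε, ?_⟩
  filter_upwards [hxK] with y hy f hf
  exact hf y hy

theorem isCompact_preimage_val {K : Set (EuclideanSpace ℝ (Fin d))} (hΩ : K ⊆ Ω)
    (hK : IsCompact K) : IsCompact (Subtype.val ⁻¹' K : Set Ω) :=
  (IsInducing.subtypeVal.isCompact_preimage_iff (by simpa using hΩ)).2 hK

theorem eventually_add_smul_single_mem (n : Fin d) (x : Ω) :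
    ∀ᶠ h : ℝ in 𝓝[≠] 0,
      (x : EuclideanSpace ℝ (Fin d)) + h • EuclideanSpace.single n (1 : ℝ) ∈ Ω := by
  have h1 : Continuous fun h : ℝ =>
      (x : EuclideanSpace ℝ (Fin d)) + h • EuclideanSpace.single n (1 : ℝ) := by fun_prop
  exact nhdsWithin_le_nhds (h1.continuousAt.eventually_mem (Ω.isOpen.mem_nhds (by simp)))

open Classical in
/-- The difference quotients of `x ↦ (f ↦ ∂_w f x)`. -/
noncomputable def wordEvalQuot (𝕜 : Type*) [RCLike 𝕜] (k : ℕ∞) (w : List (Fin d))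
    (hw : (w.length : ℕ∞) ≤ k) (n : Fin d) (x : Ω) (h : ℝ) : KappaDual 𝕜 (CW 𝕜 k Ω 𝕜) :=
  if hx : (x : EuclideanSpace ℝ (Fin d)) + h • EuclideanSpace.single n (1 : ℝ) ∈ Ω then
    (h : 𝕜)⁻¹ • (wordEval 𝕜 k w hw ⟨_, hx⟩ - wordEval 𝕜 k w hw x)
  else 0

omit [UniformSpace E] [IsUniformAddGroup E] [ContinuousSMul 𝕜 E] [T2Space E] in
theorem diffQuot_of_mem {n : Fin d} {f : Ω → E} {x : Ω} {h : ℝ}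
    (hx : (x : EuclideanSpace ℝ (Fin d)) + h • EuclideanSpace.single n (1 : ℝ) ∈ Ω) :
    diffQuot n f x h = (h : 𝕜)⁻¹ • (f ⟨_, hx⟩ - f x) := by
  rw [diffQuot, ← RCLike.ofReal_inv, ← RCLike.real_smul_eq_coe_smul (K := 𝕜)]
  congr 2
  exact Subtype.val_injective.extend_apply f 0 ⟨_, hx⟩

theorem wordEvalQuot_apply {w : List (Fin d)} (hw : (w.length : ℕ∞) ≤ k) {n : Fin d} {x : Ω}
    {h : ℝ} (hx : (x : EuclideanSpace ℝ (Fin d)) + h • EuclideanSpace.single n (1 : ℝ) ∈ Ω)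
    (f : CW 𝕜 k Ω 𝕜) :
    wordEvalQuot 𝕜 k w hw n x h f = diffQuot n (wordDer w (f : Ω → 𝕜)) x h := by
  rw [wordEvalQuot, dif_pos hx, diffQuot_of_mem (𝕜 := 𝕜) hx]
  rfl

/-- Pointwise convergence is the definition of the derivative. Equicontinuity comes from the mean
value inequality, which bounds the quotients by the supremum of the next derivative over a closed
ball in `Ω`. -/
theorem tendsto_wordEvalQuot {w : List (Fin d)} {n : Fin d} (hw : ((n :: w).length : ℕ∞) ≤ k)
    (x : Ω) : Tendsto (wordEvalQuot 𝕜 k w (CW.length_le_of_cons hw) n x) (𝓝[≠] 0)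
      (𝓝 (wordEval 𝕜 k (n :: w) hw x)) := by
  refine KappaDual.tendsto_of_eventually_le (fun ε hε => ?_) fun f => ?_
  · obtain ⟨r, hr, hball⟩ := Metric.nhds_basis_closedBall.mem_iff.1 (Ω.isOpen.mem_nhds x.2)
    have hK : IsCompact (Subtype.val ⁻¹' Metric.closedBall (x : EuclideanSpace ℝ (Fin d)) r :
        Set Ω) := isCompact_preimage_val hball (isCompact_closedBall _ _)
    refine ⟨_, CW.eventually_norm_wordDer_le hw hK hε, ?_⟩
    have hsmall : ∀ᶠ h : ℝ in 𝓝[≠] 0, |h| < r :=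
      nhdsWithin_le_nhds ((continuous_abs.tendsto 0).eventually_lt_const (by simpa using hr))
    filter_upwards [hsmall, eventually_add_smul_single_mem n x, self_mem_nhdsWithin]
      with h hh hx h0 f hf
    have h1 := (f.hasPartial_wordDer hw).norm_sub_sub_le (x := x) (h := h) (c := 0) (ε := ε)
      (fun t ht => by
        have htr : |t| ≤ r := by
          have := abs_sub_left_of_mem_uIcc ht
          simp only [sub_zero] at this
          exact this.trans hh.le
        have hmem : (x : EuclideanSpace ℝ (Fin d)) + t • EuclideanSpace.single n (1 : ℝ) ∈
            Metric.closedBall (x : EuclideanSpace ℝ (Fin d)) r := by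
          simpa [norm_smul] using htr
        refine ⟨hball hmem, ?_⟩
        rw [sub_zero]
        exact hf ⟨_, hball hmem⟩ hmem)
    rw [smul_zero, sub_zero, extendZero_of_mem _ hx, extendZero_apply] at h1
    rw [wordEvalQuot_apply _ hx, diffQuot_of_mem (𝕜 := 𝕜) hx, norm_smul, norm_inv,
      RCLike.norm_ofReal, inv_mul_le_iff₀ (abs_pos.2 h0), mul_comm]
    exact h1
  · refine ((f.hasPartial_wordDer hw).tendsto x).congr' ?_
    filter_upwards [eventually_add_smul_single_mem n x] with h hx
    exact (wordEvalQuot_apply _ hx f).symm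

/-! ### The map `S` -/

omit [IsUniformAddGroup E] [ContinuousSMul 𝕜 E] [T2Space E] in
theorem tendsto_diffQuot_apply_wordEval (u : KappaDual 𝕜 (CW 𝕜 k Ω 𝕜) →L[𝕜] E)
    {w : List (Fin d)} {n : Fin d} (hw : ((n :: w).length : ℕ∞) ≤ k) (x : Ω) :
    Tendsto (diffQuot n (fun y => u (wordEval 𝕜 k w (CW.length_le_of_cons hw) y)) x) (𝓝[≠] 0)
      (𝓝 (u (wordEval 𝕜 k (n :: w) hw x))) := by
  refine ((u.continuous.tendsto _).comp (tendsto_wordEvalQuot hw x)).congr' ?_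
  filter_upwards [eventually_add_smul_single_mem n x] with h hx
  rw [Function.comp_apply, wordEvalQuot, dif_pos hx, diffQuot_of_mem (𝕜 := 𝕜) hx, map_smul, map_sub]

omit [IsUniformAddGroup E] [ContinuousSMul 𝕜 E] in
theorem wordDer_apply_pointEval (u : KappaDual 𝕜 (CW 𝕜 k Ω 𝕜) →L[𝕜] E)
    (w : List (Fin d)) (hw : (w.length : ℕ∞) ≤ k) :
    wordDer w (fun x : Ω => u (pointEval 𝕜 k x)) = fun x => u (wordEval 𝕜 k w hw x) := by
  induction w with
  | nil => rfl
  | cons n w ih =>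
    rw [wordDer_cons, ih (CW.length_le_of_cons hw)]
    exact funext fun x => partialDer_eq (tendsto_diffQuot_apply_wordEval u hw x)

theorem apply_pointEval_mem (u : KappaDual 𝕜 (CW 𝕜 k Ω 𝕜) →L[𝕜] E) :
    (fun x : Ω => u (pointEval 𝕜 k x)) ∈ ckSubmodule 𝕜 k Ω E := by
  intro m hm
  refine isC_of_wordDer (fun w hw => ?_) (fun w hw n x => ?_)
  · rw [wordDer_apply_pointEval u w (le_trans (by exact_mod_cast hw) hm)]
    exact u.continuous.comp (continuous_wordEval w _)
  · have hw' : ((n :: w).length : ℕ∞) ≤ k := le_trans (by exact_mod_cast hw) hm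
    rw [wordDer_apply_pointEval u w (CW.length_le_of_cons hw')]
    exact ⟨_, tendsto_diffQuot_apply_wordEval u hw' x⟩

/-- The map `S(u)(x) = u(δ_x)`. -/
noncomputable def evalMap (𝕜 : Type*) [RCLike 𝕜] {d : ℕ} (k : ℕ∞)
    (Ω : Opens (EuclideanSpace ℝ (Fin d)))
    (E : Type*) [AddCommGroup E] [Module 𝕜 E] [Module ℝ E] [IsScalarTower ℝ 𝕜 E]
    [UniformSpace E] [IsUniformAddGroup E] [ContinuousSMul 𝕜 E] [T2Space E] :
    EpsProduct 𝕜 (CW 𝕜 k Ω 𝕜) E →ₗ[𝕜] CW 𝕜 k Ω E where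
  toFun u := ⟨fun x => u (pointEval 𝕜 k x),
    apply_pointEval_mem (u : KappaDual 𝕜 (CW 𝕜 k Ω 𝕜) →L[𝕜] E)⟩
  map_add' _ _ := rfl
  map_smul' _ _ := rfl

theorem wordDer_evalMap (u : EpsProduct 𝕜 (CW 𝕜 k Ω 𝕜) E) {w : List (Fin d)}
    (hw : (w.length : ℕ∞) ≤ k) (x : Ω) :
    wordDer w (evalMap 𝕜 k Ω E u : Ω → E) x = u (wordEval 𝕜 k w hw x) :=
  congrFun (wordDer_apply_pointEval (u : KappaDual 𝕜 (CW 𝕜 k Ω 𝕜) →L[𝕜] E) w hw) x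

theorem equicontinuous_of_eventually_le {F : Type*} [AddCommGroup F] [Module 𝕜 F]
    [TopologicalSpace F] [IsTopologicalAddGroup F] {H : Set (KappaDual 𝕜 F)}
    (hH : ∀ ε > 0, ∀ᶠ f in 𝓝 (0 : F), ∀ y ∈ H, ‖y f‖ ≤ ε) :
    Equicontinuous fun (y : H) (f : F) => (y : KappaDual 𝕜 F) f := by
  intro f₀
  rw [Metric.equicontinuousAt_iff_right]
  intro ε hε
  have h1 : Tendsto (fun f => f - f₀) (𝓝 f₀) (𝓝 0) := by
    have := (show Continuous fun f : F => f - f₀ by fun_prop).tendsto f₀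
    rwa [sub_self] at this
  filter_upwards [h1.eventually (hH (ε / 2) (by positivity))] with f hf y
  rw [dist_comm, dist_eq_norm, ← map_sub]
  exact (hf y y.2).trans_lt (half_lt_self hε)

/-- The functionals `f ↦ ∂^β f x` with `x` in a compact set are equicontinuous, so uniform
convergence on equicontinuous sets controls `∂^β S(u)` on compact sets. -/
theorem continuous_evalMap : Continuous (evalMap 𝕜 k Ω E) := by
  refine continuous_iInf_rng.2 fun β => continuous_induced_rng.2 ?_
  set 𝔖 := {H : Set (KappaDual 𝕜 (CW 𝕜 k Ω 𝕜)) | Equicontinuous fun (y : H) (f : CW 𝕜 k Ω 𝕜) =>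
    (y : KappaDual 𝕜 (CW 𝕜 k Ω 𝕜)) f} with h𝔖
  have h1 : (fun f : CW 𝕜 k Ω E => UniformOnFun.ofFun {K : Set Ω | IsCompact K}
      (iterPartial β.1 (f : Ω → E))) ∘ evalMap 𝕜 k Ω E =
      (fun φ : KappaDual 𝕜 (CW 𝕜 k Ω 𝕜) →ᵤ[𝔖] E => UniformOnFun.ofFun {K : Set Ω | IsCompact K}
        (UniformOnFun.toFun 𝔖 φ ∘
          wordEval 𝕜 k (multiIndexWord β.1) (CW.length_multiIndexWord_le β.2))) ∘
      (UniformOnFun.ofFun 𝔖 ∘ DFunLike.coe) := by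
    funext u
    refine congrArg (UniformOnFun.ofFun _) ?_
    rw [iterPartial_eq_wordDer]
    exact funext fun x => wordDer_evalMap u _ x
  rw [h1]
  refine (UniformOnFun.precomp_uniformContinuous ?_).continuous.comp
    (UniformConvergenceCLM.isEmbedding_coeFn (RingHom.id 𝕜) E _).continuous
  intro K hK
  refine equicontinuous_of_eventually_le fun ε hε => ?_
  filter_upwards [CW.eventually_norm_wordDer_le (CW.length_multiIndexWord_le β.2) hK hε] with f hf
  rintro _ ⟨x, hx, rfl⟩
  exact hf x hx

end CWTopology

/-! ### Composition with continuous linear forms -/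

section Postcomp

variable {𝕜 : Type*} [RCLike 𝕜] {d : ℕ} {k : ℕ∞} {Ω : Opens (EuclideanSpace ℝ (Fin d))}
  {E : Type*} [AddCommGroup E] [Module 𝕜 E] [Module ℝ E] [IsScalarTower ℝ 𝕜 E]
  [UniformSpace E] [IsUniformAddGroup E] [ContinuousSMul 𝕜 E] [T2Space E]

/-- The function `g ∘ f`, for a continuous linear form `g`. -/
def CW.postcomp (f : CW 𝕜 k Ω E) (g : E →L[𝕜] 𝕜) : CW 𝕜 k Ω 𝕜 :=
  ⟨g ∘ (f : Ω → E), fun _ hm => (f.isC hm).comp g⟩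

theorem CW.iterPartial_postcomp (f : CW 𝕜 k Ω E) (g : E →L[𝕜] 𝕜) {β : Fin d → ℕ}
    (hβ : ((∑ n, β n : ℕ) : ℕ∞) ≤ k) :
    iterPartial β (f.postcomp g : Ω → 𝕜) = g ∘ iterPartial β (f : Ω → E) := by
  simp only [iterPartial_eq_wordDer]
  exact IsC.wordDer_comp (f.isC (CW.length_multiIndexWord_le hβ)) f.continuous_coe g

theorem CW.postcomp_add (f : CW 𝕜 k Ω E) (g g' : E →L[𝕜] 𝕜) :
    f.postcomp (g + g') = f.postcomp g + f.postcomp g' := rfl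

theorem CW.postcomp_smul (f : CW 𝕜 k Ω E) (c : 𝕜) (g : E →L[𝕜] 𝕜) :
    f.postcomp (c • g) = c • f.postcomp g := rfl

/-- `g (u y) = y (g ∘ S u)`. -/
theorem apply_eq_apply_postcomp_evalMap (u : EpsProduct 𝕜 (CW 𝕜 k Ω 𝕜) E) (g : E →L[𝕜] 𝕜)
    (y : KappaDual 𝕜 (CW 𝕜 k Ω 𝕜)) : g (u y) = y ((evalMap 𝕜 k Ω E u).postcomp g) := by
  obtain ⟨f, hf⟩ := KappaDual.exists_eq_eval
    (g.comp (u : KappaDual 𝕜 (CW 𝕜 k Ω 𝕜) →L[𝕜] E))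
  -- Testing the representing element on point evaluations identifies it.
  have h : f = (evalMap 𝕜 k Ω E u).postcomp g :=
    Subtype.ext (funext fun x => (hf (pointEval 𝕜 k x)).symm)
  rw [← h]
  exact hf y

variable [LocallyConvexSpace ℝ E]

theorem evalMap_injective : Function.Injective (evalMap 𝕜 k Ω E) := by
  intro u v h
  ext y
  refine eq_of_forall_dual_eq (𝕜 := 𝕜) fun g => ?_
  rw [apply_eq_apply_postcomp_evalMap, apply_eq_apply_postcomp_evalMap, h]

variable (𝕜 E) in
omit [ContinuousSMul 𝕜 E] [T2Space E] in
theorem locallyConvexSpace_rclike : LocallyConvexSpace 𝕜 E := by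
  rw [locallyConvexSpace_iff_exists_convex_subset_zero]
  intro U hU
  obtain ⟨S, hS, hSc, hSU⟩ := (locallyConvexSpace_iff_exists_convex_subset_zero ℝ E).1 ‹_› U hU
  exact ⟨S, hS, convex_rclike_iff_convex_real.2 hSc, hSU⟩

variable (𝕜) in
omit [T2Space E] in
theorem exists_closed_absConvex_subset {U : Set E} (hU : U ∈ 𝓝 0) :
    ∃ V ∈ 𝓝 (0 : E), IsClosed V ∧ AbsConvex 𝕜 V ∧ V ⊆ U := by
  have := locallyConvexSpace_rclike 𝕜 E
  obtain ⟨V, ⟨hV, hVc, hVa⟩, hVU⟩ := (nhds_hasBasis_absConvex_closed 𝕜 E).mem_iff.1 hU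
  exact ⟨V, hV, hVc, hVa, hVU⟩

/-- Continuity of the inverse at `0`, phrased without the inverse. If the relevant derivatives of
`f` lie in `ε W`, those of `g ∘ f` are at most `ε` for every `g` in the polar of `W`, so `|g (u y)|
= |y (g ∘ f)| ≤ 1` and `u y ∈ W` by the bipolar theorem. -/
theorem eventually_mapsTo_of_evalMap {H : Set (KappaDual 𝕜 (CW 𝕜 k Ω 𝕜))}
    (hH : Equicontinuous fun (y : H) (f : CW 𝕜 k Ω 𝕜) => (y : KappaDual 𝕜 (CW 𝕜 k Ω 𝕜)) f)
    {V : Set E} (hV : V ∈ 𝓝 0) :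
    ∀ᶠ f : CW 𝕜 k Ω E in 𝓝 0, ∀ u : EpsProduct 𝕜 (CW 𝕜 k Ω 𝕜) E,
      evalMap 𝕜 k Ω E u = f → MapsTo u H V := by
  obtain ⟨W, hW, hWc, hWa, hWV⟩ := exists_closed_absConvex_subset 𝕜 hV
  have hU : {f : CW 𝕜 k Ω 𝕜 | ∀ y ∈ H, ‖y f‖ ≤ 1} ∈ 𝓝 0 := by
    filter_upwards [Metric.equicontinuousAt_iff_right.1 (hH 0) 1 one_pos] with f hf y hy
    have := hf ⟨y, hy⟩
    simp only [map_zero, dist_zero_left] at this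
    exact this.le
  obtain ⟨K, s, B, hK, hs, hB, hU'⟩ := CW.exists_of_mem_nhds_zero hU
  obtain ⟨ε, hε, hεB⟩ := Metric.nhds_basis_closedBall.mem_iff.1 hB
  have hε' : (ε : 𝕜) ≠ 0 := by exact_mod_cast hε.ne'
  have hev : ∀ᶠ f : CW 𝕜 k Ω E in 𝓝 0, ∀ β ∈ s, ∀ x ∈ K,
      iterPartial β.1 (f : Ω → E) x ∈ (ε : 𝕜) • W :=
    (eventually_all_finite hs).2 fun β _ => CW.eventually_iterPartial_mem β.2 hK
      ((set_smul_mem_nhds_zero_iff hε').2 hW)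
  filter_upwards [hev] with f hf u hu y hy
  refine hWV ?_
  by_contra hnot
  obtain ⟨g, hg, hg1⟩ := exists_dual_of_notMem hWc hWa ⟨0, mem_of_mem_nhds hW⟩ hnot
  rw [apply_eq_apply_postcomp_evalMap, hu] at hg1
  refine absurd (hU' (f.postcomp g) (fun β hβ x hx => hεB ?_) y hy) (not_le.2 hg1)
  rw [CW.iterPartial_postcomp f g β.2, mem_closedBall_zero_iff, Function.comp_apply]
  obtain ⟨a, ha, hax⟩ := hf β hβ x hx
  rw [← hax, map_smul, norm_smul, RCLike.norm_ofReal, abs_of_pos hε]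
  exact mul_le_of_le_one_right hε.le (hg a ha)

omit [LocallyConvexSpace ℝ E] in
/-- The set of all `g ∘ f`, `g` in the polar of a neighbourhood of zero, is compact. -/
theorem CW.isCompact_image_postcomp (f : CW 𝕜 k Ω E) {V : Set E} (hV : V ∈ 𝓝 0) :
    IsCompact (f.postcomp '' {g | ∀ a ∈ V, ‖g a‖ ≤ 1}) := by
  let P := {g : E →L[𝕜] 𝕜 // ∀ a ∈ V, ‖g a‖ ≤ 1}
  let : TopologicalSpace P := TopologicalSpace.induced (fun g => (g.1 : E → 𝕜)) inferInstance
  have : CompactSpace P := compactSpace_polar hV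
  have hcont : Continuous fun g : P => f.postcomp g.1 := by
    refine continuous_iInf_rng.2 fun β => continuous_induced_rng.2 ?_
    rw [continuous_iff_continuousAt]
    intro g₀
    have heq : (fun h : CW 𝕜 k Ω 𝕜 => UniformOnFun.ofFun {K : Set Ω | IsCompact K}
        (iterPartial β.1 (h : Ω → 𝕜))) ∘ (fun g : P => f.postcomp g.1) =
        UniformOnFun.ofFun {K : Set Ω | IsCompact K} ∘
          fun g : P => g.1 ∘ iterPartial β.1 (f : Ω → E) :=
      funext fun g => congrArg (UniformOnFun.ofFun _) (f.iterPartial_postcomp g.1 β.2)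
    rw [heq, ContinuousAt]
    -- The functions `g ∘ ∂^β f`, with `g` in the polar, are equicontinuous, so compact convergence
    -- reduces to pointwise convergence, which the topology of `P` provides.
    refine (EquicontinuousOn.tendsto_uniformOnFun_iff_pi (fun K hK => hK)
      (sUnion_eq_univ_iff.2 fun x => ⟨{x}, isCompact_singleton, rfl⟩) (fun K _ => ?_) _ _).2 ?_
    · refine Equicontinuous.equicontinuousOn (fun x₀ => ?_) K
      rw [Metric.equicontinuousAt_iff_right]
      intro ε hε
      have hε' : ((ε / 2 : ℝ) : 𝕜) ≠ 0 := by exact_mod_cast (half_pos hε).ne'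
      have h1 : Tendsto (fun x => iterPartial β.1 (f : Ω → E) x - iterPartial β.1 (f : Ω → E) x₀)
          (𝓝 x₀) (𝓝 0) := by
        have := ((f.continuous_iterPartial β.2).tendsto x₀).sub_const
          (iterPartial β.1 (f : Ω → E) x₀)
        rwa [sub_self] at this
      filter_upwards [h1.eventually ((set_smul_mem_nhds_zero_iff hε').2 hV)] with x hx g
      obtain ⟨a, ha, hax⟩ := hx
      simp only at hax
      rw [dist_comm, dist_eq_norm, Function.comp_apply, Function.comp_apply, ← map_sub, ← hax,
        map_smul, norm_smul, RCLike.norm_ofReal, abs_of_pos (half_pos hε)]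
      exact (mul_le_of_le_one_right (half_pos hε).le (g.2 a ha)).trans_lt (half_lt_self hε)
    · rw [tendsto_pi_nhds]
      intro x
      have h2 : Continuous fun g : P => g.1 (iterPartial β.1 (f : Ω → E) x) :=
        (continuous_apply (iterPartial β.1 (f : Ω → E) x)).comp continuous_induced_dom
      exact h2.tendsto g₀
  have := isCompact_range hcont
  convert this using 1
  ext h
  constructor
  · rintro ⟨g, hg, rfl⟩
    exact ⟨⟨g, hg⟩, rfl⟩
  · rintro ⟨g, rfl⟩
    exact ⟨g.1, g.2, rfl⟩

omit [LocallyConvexSpace ℝ E] in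
theorem CW.absConvex_image_postcomp (f : CW 𝕜 k Ω E) (V : Set E) :
    AbsConvex 𝕜 (f.postcomp '' {g | ∀ a ∈ V, ‖g a‖ ≤ 1}) := by
  constructor
  · rintro c hc _ ⟨_, ⟨g, hg, rfl⟩, rfl⟩
    refine ⟨c • g, fun a ha => ?_, f.postcomp_smul c g⟩
    rw [_root_.smul_apply, norm_smul]
    exact mul_le_one₀ hc (norm_nonneg _) (hg a ha)
  · rintro _ ⟨g, hg, rfl⟩ _ ⟨g', hg', rfl⟩ a b ha hb hab
    refine ⟨a • g + b • g', fun v hv => ?_, rfl⟩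
    have h1 : ‖a‖ + ‖b‖ = 1 := by
      obtain ⟨a, ha', rfl⟩ := RCLike.nonneg_iff_exists_ofReal.1 ha
      obtain ⟨b, hb', rfl⟩ := RCLike.nonneg_iff_exists_ofReal.1 hb
      rw [RCLike.norm_ofReal, RCLike.norm_ofReal, abs_of_nonneg ha', abs_of_nonneg hb']
      exact_mod_cast hab
    calc ‖a • g v + b • g' v‖ ≤ ‖a‖ * ‖g v‖ + ‖b‖ * ‖g' v‖ := by
          rw [← norm_smul, ← norm_smul]; exact norm_add_le _ _
      _ ≤ ‖a‖ * 1 + ‖b‖ * 1 := by gcongr; exacts [hg v hv, hg' v hv]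
      _ = 1 := by rw [mul_one, mul_one, h1]

end Postcomp

/-! ### Surjectivity -/

section Surjectivity

variable {𝕜 : Type*} [RCLike 𝕜] {d : ℕ} {k : ℕ∞} {Ω : Opens (EuclideanSpace ℝ (Fin d))}
  {E : Type*} [AddCommGroup E] [Module 𝕜 E] [Module ℝ E] [IsScalarTower ℝ 𝕜 E]
  [UniformSpace E] [IsUniformAddGroup E] [ContinuousSMul 𝕜 E] [T2Space E]

/-- This produces the value `u y` of the preimage of `f`, as a multiple of a point of a compact set
containing the derivative values that control `y`. -/
theorem CW.exists_dual_apply_eq (f : CW 𝕜 k Ω E)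
    (hC' : ∀ β : {β : Fin d → ℕ // ((∑ n, β n : ℕ) : ℕ∞) ≤ k}, ∀ K : Set Ω, IsCompact K →
      ∃ C : Set E, IsCompact C ∧ AbsConvex 𝕜 C ∧ iterPartial β.1 (f : Ω → E) '' K ⊆ C)
    (y : KappaDual 𝕜 (CW 𝕜 k Ω 𝕜)) : ∃ z : E, ∀ g : E →L[𝕜] 𝕜, g z = y (f.postcomp g) := by
  have hy : {f : CW 𝕜 k Ω 𝕜 | ‖y f‖ < 1} ∈ 𝓝 0 := by
    have : ContinuousAt (fun f => ‖y f‖) 0 :=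
      (ContinuousLinearMap.continuous (y : CW 𝕜 k Ω 𝕜 →L[𝕜] 𝕜)).norm.continuousAt
    refine this.eventually (gt_mem_nhds ?_)
    simp
  obtain ⟨K, s, B, hK, hs, hB, hU⟩ := CW.exists_of_mem_nhds_zero hy
  obtain ⟨ε, hε, hεB⟩ := Metric.nhds_basis_closedBall.mem_iff.1 hB
  obtain ⟨C, ⟨z₀, hz₀⟩, hC, hCc, hsC⟩ : ∃ C : Set E, C.Nonempty ∧ IsCompact C ∧ AbsConvex 𝕜 C ∧
      ∀ β ∈ s, iterPartial β.1 (f : Ω → E) '' K ⊆ C := by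
    clear hU
    induction s, hs using Set.Finite.induction_on with
    | empty => exact ⟨{0}, singleton_nonempty 0, isCompact_singleton,
        ⟨balanced_zero, convex_singleton 0⟩, fun β hβ => absurd hβ (notMem_empty β)⟩
    | @insert β s _ _ ih =>
      obtain ⟨C, hCn, hC, hCa, hsC⟩ := ih
      obtain ⟨D, hD, hDa, hβD⟩ := hC' β K hK
      obtain ⟨A, hA, hAa, hCA, hDA⟩ := exists_isCompact_absConvex_union hC hCa hD hDa
      refine ⟨A, hCn.mono hCA, hA, hAa, ?_⟩
      rintro γ (rfl | hγ)
      · exact hβD.trans hDA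
      · exact (hsC γ hγ).trans hCA
  let φ : (E →L[𝕜] 𝕜) →ₗ[𝕜] 𝕜 :=
    { toFun := fun g => (ε : 𝕜) * y (f.postcomp g)
      map_add' := fun g g' => by rw [f.postcomp_add, map_add, mul_add]
      map_smul' := fun c g => by rw [f.postcomp_smul, map_smul, smul_eq_mul, mul_left_comm]; rfl }
  let A : E →ₗ[𝕜] (E →L[𝕜] 𝕜) →ₗ[𝕜] 𝕜 :=
    LinearMap.mk₂ 𝕜 (fun x g => g x) (fun _ _ _ => map_add _ _ _) (fun _ _ _ => map_smul _ _ _)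
      (fun _ _ _ => rfl) (fun _ _ _ => rfl)
  have hφ : ∀ g M, (∀ x ∈ C, ‖A x g‖ ≤ M) → ‖φ g‖ ≤ M := by
    intro g M hM
    change ‖(ε : 𝕜) * y (f.postcomp g)‖ ≤ M
    have hM0 : 0 ≤ M := (norm_nonneg _).trans (hM z₀ hz₀)
    -- `M` may vanish, so the scaling uses `M' > M` instead.
    refine le_of_forall_gt_imp_ge_of_dense fun M' hM' => ?_
    have hM'0 : 0 < M' := hM0.trans_lt hM'
    have h1 : ‖y (f.postcomp (((ε / M' : ℝ) : 𝕜) • g))‖ < 1 := by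
      refine hU _ fun β hβ x hx => hεB ?_
      rw [CW.iterPartial_postcomp f _ β.2, mem_closedBall_zero_iff, Function.comp_apply,
        _root_.smul_apply, norm_smul, RCLike.norm_ofReal, abs_of_pos (div_pos hε hM'0),
        div_mul_eq_mul_div, div_le_iff₀ hM'0]
      gcongr
      exact (hM _ (hsC β hβ (mem_image_of_mem _ hx))).trans hM'.le
    rw [f.postcomp_smul, map_smul, norm_smul, RCLike.norm_ofReal, abs_of_pos (div_pos hε hM'0),
      div_mul_eq_mul_div, div_lt_one hM'0] at h1
    rw [norm_mul, RCLike.norm_ofReal, abs_of_pos hε]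
    exact h1.le
  obtain ⟨z, -, hz⟩ := exists_mem_forall_apply_eq hC hCc A (fun g => g.continuous) φ hφ
  refine ⟨(ε : 𝕜)⁻¹ • z, fun g => ?_⟩
  have h1 : g z = ε * y (f.postcomp g) := hz g
  rw [map_smul, h1, smul_eq_mul, inv_mul_cancel_left₀ (by exact_mod_cast hε.ne')]

variable [LocallyConvexSpace ℝ E]

/-- The vectors `z` are unique by Hahn–Banach, hence linear in `y`. For continuity, if `y` is
bounded by `1` on the compact set of all `g ∘ f` with `g` in the polar of `W`, then `u y ∈ W`. -/
theorem CW.exists_evalMap_eq (f : CW 𝕜 k Ω E)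
    (hf : ∀ y : KappaDual 𝕜 (CW 𝕜 k Ω 𝕜), ∃ z : E, ∀ g : E →L[𝕜] 𝕜, g z = y (f.postcomp g)) :
    ∃ u, evalMap 𝕜 k Ω E u = f := by
  choose v hv using hf
  let u : KappaDual 𝕜 (CW 𝕜 k Ω 𝕜) →ₗ[𝕜] E :=
    { toFun := v
      map_add' := fun y y' => eq_of_forall_dual_eq (𝕜 := 𝕜) fun g => by
        rw [map_add, hv, hv, hv]; rfl
      map_smul' := fun c y => eq_of_forall_dual_eq (𝕜 := 𝕜) fun g => by
        rw [map_smul, hv, hv]; rfl }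
  have hu : Continuous u := by
    refine continuous_of_continuousAt_zero u ?_
    rw [ContinuousAt, map_zero]
    refine tendsto_def.2 fun V hV => ?_
    obtain ⟨W, hW, hWc, hWa, hWV⟩ := exists_closed_absConvex_subset 𝕜 hV
    filter_upwards [UniformConvergenceCLM.eventually_nhds_zero_mapsTo (RingHom.id 𝕜)
      (𝔖 := {K : Set (CW 𝕜 k Ω 𝕜) | AbsConvex 𝕜 K ∧ IsCompact K})
      ⟨f.absConvex_image_postcomp W, f.isCompact_image_postcomp hW⟩
      (Metric.closedBall_mem_nhds (0 : 𝕜) one_pos)] with y hy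
    refine hWV ?_
    by_contra hnot
    obtain ⟨g, hg, hg1⟩ := exists_dual_of_notMem hWc hWa ⟨0, mem_of_mem_nhds hW⟩ hnot
    have h1 := hy (mem_image_of_mem _ hg)
    rw [mem_closedBall_zero_iff, ← hv] at h1
    exact absurd h1 (not_le.2 hg1)
  refine ⟨UniformConvergenceCLM.ofFun (RingHom.id 𝕜) E _ ⟨u, hu⟩, ?_⟩
  refine Subtype.ext (funext fun x => eq_of_forall_dual_eq (𝕜 := 𝕜) fun g => ?_)
  exact hv (pointEval 𝕜 k x) g

/-- The isomorphism `CW^k(Ω) ε E ≅ CW^k(Ω, E)`. -/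
theorem exists_continuousLinearEquiv
    (hC : ∀ (f : CW 𝕜 k Ω E) (β : {β : Fin d → ℕ // ((∑ n, β n : ℕ) : ℕ∞) ≤ k}) (K : Set Ω),
      IsCompact K → ∃ C : Set E, IsCompact C ∧ AbsConvex 𝕜 C ∧
        iterPartial β.1 (f : Ω → E) '' K ⊆ C) :
    ∃ S : EpsProduct 𝕜 (CW 𝕜 k Ω 𝕜) E ≃L[𝕜] CW 𝕜 k Ω E,
      ∀ (u : EpsProduct 𝕜 (CW 𝕜 k Ω 𝕜) E) (x : Ω), S u x = u (pointEval 𝕜 k x) := by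
  let S := LinearEquiv.ofBijective (evalMap 𝕜 k Ω E)
    ⟨evalMap_injective, fun f => f.exists_evalMap_eq (f.exists_dual_apply_eq (hC f))⟩
  refine ⟨⟨S, continuous_evalMap, ?_⟩, fun u x => rfl⟩
  refine continuous_of_continuousAt_zero S.symm ?_
  rw [ContinuousAt, map_zero, UniformConvergenceCLM.nhds_zero_eq]
  simp only [tendsto_iInf, tendsto_principal]
  intro H hH V hV
  filter_upwards [eventually_mapsTo_of_evalMap hH hV] with f hf
  exact hf (S.symm f) (S.apply_symm_apply f)

end Surjectivity

/-! ### Compact absolutely convex sets containing the values of derivatives -/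

section MetricCCP

/-- For a finite union of basic sets, the points whose fibre lies in it form an open set, since `f`
is closed. These countably many sets form a basis because fibres are compact. -/
theorem secondCountableTopology_of_surjective {X Y : Type*} [TopologicalSpace X]
    [TopologicalSpace Y] [CompactSpace X] [SecondCountableTopology X] [T2Space Y] {f : X → Y}
    (hf : Continuous f) (hs : Function.Surjective f) : SecondCountableTopology Y := by
  let B := countableBasis X
  let U (t : Set (Set X)) : Set Y := (f '' (⋃₀ t)ᶜ)ᶜ
  let 𝒯 : Set (Set (Set X)) := {t | t.Finite ∧ t ⊆ B}
  have h𝒯 : 𝒯.Countable := Set.countable_ofPred_finite_subset (countable_countableBasis X)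
  have hB : IsTopologicalBasis B := isBasis_countableBasis X
  refine (isTopologicalBasis_of_isOpen_of_nhds (s := U '' 𝒯) ?_ ?_).secondCountableTopology
    (h𝒯.image U)
  · rintro _ ⟨t, ⟨-, ht⟩, rfl⟩
    have h1 : IsOpen (⋃₀ t) := isOpen_sUnion fun s hs => hB.isOpen (ht hs)
    exact ((h1.isClosed_compl.isCompact.image hf).isClosed).isOpen_compl
  · intro y V hy hV
    have hK : IsCompact (f ⁻¹' {y}) := (isClosed_singleton.preimage hf).isCompact
    have h1 : ∀ x ∈ f ⁻¹' {y}, ∃ s ∈ B, x ∈ s ∧ s ⊆ f ⁻¹' V := fun x hx =>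
      hB.exists_subset_of_mem_open (show f x ∈ V by rw [show f x = y from hx]; exact hy)
        (hV.preimage hf)
    choose! s hsB hxs hsV using h1
    obtain ⟨t, ht, htK⟩ := hK.elim_nhds_subcover s fun x hx =>
      (hB.isOpen (hsB x hx)).mem_nhds (hxs x hx)
    refine ⟨_, ⟨s '' t, ⟨t.finite_toSet.image s, ?_⟩, rfl⟩, ?_, ?_⟩
    · rintro _ ⟨x, hx, rfl⟩
      exact hsB x (ht x hx)
    · rintro ⟨x, hx, hxy⟩
      refine hx ?_
      obtain ⟨z, hz, hxz⟩ := mem_iUnion₂.1 (htK hxy)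
      exact ⟨s z, mem_image_of_mem s hz, hxz⟩
    · intro z hz
      obtain ⟨x, rfl⟩ := hs z
      by_contra hx
      refine hz ⟨x, fun hxt => hx ?_, rfl⟩
      obtain ⟨_, ⟨w, hw, rfl⟩, hxw⟩ := hxt
      exact hsV w (ht w hw) hxw

theorem IsCompact.metrizableSpace_image {X Y : Type*} [TopologicalSpace X]
    [SecondCountableTopology X] [TopologicalSpace Y] [T2Space Y] {f : X → Y} {K : Set X}
    (hK : IsCompact K) (hf : Continuous f) : MetrizableSpace (f '' K) := by
  have := isCompact_iff_compactSpace.1 hK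
  have := isCompact_iff_compactSpace.1 (hK.image hf)
  have := secondCountableTopology_of_surjective (f := K.imageFactorization f)
    ((hf.comp continuous_subtype_val).subtype_mk _) imageFactorization_surjective
  infer_instance

variable {𝕜 : Type*} [RCLike 𝕜] {d : ℕ} {k : ℕ∞} {Ω : Opens (EuclideanSpace ℝ (Fin d))}
  {E : Type*} [AddCommGroup E] [Module 𝕜 E] [Module ℝ E] [IsScalarTower ℝ 𝕜 E]
  [UniformSpace E] [IsUniformAddGroup E] [ContinuousSMul 𝕜 E] [T2Space E]

theorem HasMetricCCP.exists_isCompact_absConvex (h : HasMetricCCP 𝕜 E) (f : CW 𝕜 k Ω E)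
    {β : Fin d → ℕ} (hβ : ((∑ n, β n : ℕ) : ℕ∞) ≤ k) {K : Set Ω} (hK : IsCompact K) :
    ∃ C : Set E, IsCompact C ∧ AbsConvex 𝕜 C ∧ iterPartial β (f : Ω → E) '' K ⊆ C :=
  ⟨_, h _ (hK.image (f.continuous_iterPartial hβ))
    (hK.metrizableSpace_image (f.continuous_iterPartial hβ)),
    absConvex_absConvexHull.closure, subset_absConvexHull.trans subset_closure⟩

end MetricCCP

/-! ### Banach spaces `E_D` generated by disks -/

section LocallyComplete

variable {𝕜 : Type*} [RCLike 𝕜]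

/-- The hull lies in the convex hull of the compact set of all `c • a` with `‖c‖ ≤ 1`, `a ∈ A`, and
convex hulls of totally bounded sets are totally bounded. -/
theorem isCompact_closure_absConvexHull {X : Type*} [NormedAddCommGroup X] [NormedSpace 𝕜 X]
    [CompleteSpace X] {A : Set X} (hA : IsCompact A) : IsCompact (closure (absConvexHull 𝕜 A)) := by
  let : NormedSpace ℝ X := NormedSpace.restrictScalars ℝ 𝕜 X
  let : Module ℝ X := Module.restrictScalars ℝ 𝕜 X
  have : IsScalarTower ℝ 𝕜 X := IsScalarTower.restrictScalars ℝ 𝕜 X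
  have h1 : IsCompact (Metric.closedBall (0 : 𝕜) 1 • A) :=
    (isCompact_closedBall (0 : 𝕜) 1).smul_set hA
  have h2 : absConvexHull 𝕜 A ⊆ convexHull ℝ (Metric.closedBall (0 : 𝕜) 1 • A) := by
    rw [absConvexHull_eq_convexHull_balancedHull]
    refine convexHull_min (Subset.trans ?_ (subset_convexHull ℝ _))
      (convex_rclike_iff_convex_real.2 (convex_convexHull ℝ _))
    intro x hx
    obtain ⟨r, hr, hx⟩ := mem_balancedHull_iff.1 hx
    obtain ⟨a, ha, rfl⟩ := hx
    exact ⟨r, by simpa using hr, a, ha, rfl⟩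
  exact ((totallyBounded_convexHull.2 h1.totallyBounded).subset h2).closure.isCompact_of_isClosed
    isClosed_closure

variable {E : Type*} [AddCommGroup E] [Module 𝕜 E] [Module ℝ E] [IsScalarTower ℝ 𝕜 E]

omit [Module ℝ E] [IsScalarTower ℝ 𝕜 E] in
theorem AbsConvex.image {X : Type*} [AddCommGroup X] [Module 𝕜 X] {s : Set X}
    (hs : AbsConvex 𝕜 s) (i : X →ₗ[𝕜] E) : AbsConvex 𝕜 (i '' s) := by
  refine ⟨?_, hs.2.linear_image i⟩
  rintro c hc _ ⟨_, ⟨x, hx, rfl⟩, rfl⟩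
  exact ⟨c • x, hs.1.smul_mem hc hx, map_smul i c x⟩

omit [Module ℝ E] [IsScalarTower ℝ 𝕜 E] in
/-- The image of a compact space under a continuous map into a Banach space `X` that is continuously
embedded into `E` is contained in an absolutely convex compact subset of `E`. -/
theorem exists_isCompact_absConvex_of_seminorm [TopologicalSpace E] [IsTopologicalAddGroup E]
    [T2Space E] {X : Type*} [AddCommGroup X] [Module 𝕜 X] (p : Seminorm 𝕜 X) (i : X →ₗ[𝕜] E)
    (hinj : Function.Injective i) (hi : ∀ V ∈ 𝓝 (0 : E), ∃ ε > 0, ∀ x, p x < ε → i x ∈ V)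
    (hcomp : ∀ x : ℕ → X, (∀ ε > 0, ∃ N, ∀ m ≥ N, ∀ n ≥ N, p (x m - x n) < ε) →
      ∃ y, Tendsto (fun n => p (x n - y)) atTop (𝓝 0))
    {Q : Type*} [TopologicalSpace Q] [CompactSpace Q] (φ : Q → X)
    (hφ : ∀ q₀, ∀ ε > 0, ∀ᶠ q in 𝓝 q₀, p (φ q - φ q₀) < ε) :
    ∃ C : Set E, IsCompact C ∧ AbsConvex 𝕜 C ∧ range (i ∘ φ) ⊆ C := by
  let : Norm X := ⟨p⟩
  have core : NormedSpace.Core 𝕜 X :=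
    { norm_nonneg := apply_nonneg p
      norm_smul := map_smul_eq_mul p
      norm_triangle := map_add_le_add p
      norm_eq_zero_iff := fun x => by
        refine ⟨fun hx => ?_, fun hx => by rw [hx]; exact map_zero p⟩
        refine hinj ?_
        rw [map_zero]
        by_contra hne
        -- `p` is a norm: `p x = 0` puts `i x` into every neighbourhood of `0`, and `E` is
        -- Hausdorff.
        obtain ⟨ε, hε, h⟩ := hi {i x}ᶜ (isOpen_compl_singleton.mem_nhds (Ne.symm hne))
        exact h x (show p x < ε by rw [show p x = 0 from hx]; exact hε) rfl }
  let : NormedAddCommGroup X := NormedAddCommGroup.ofCore core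
  let : NormedSpace 𝕜 X := NormedSpace.ofCore core
  have hn (x : X) : ‖x‖ = p x := rfl
  have : CompleteSpace X := by
    refine Metric.complete_of_cauchySeq_tendsto fun x hx => ?_
    obtain ⟨y, hy⟩ := hcomp x fun ε hε => by
      obtain ⟨N, hN⟩ := Metric.cauchySeq_iff.1 hx ε hε
      exact ⟨N, fun m hm n hn' => by rw [← hn, ← dist_eq_norm]; exact hN m hm n hn'⟩
    exact ⟨y, tendsto_iff_norm_sub_tendsto_zero.2 hy⟩
  have hφc : Continuous φ := by
    refine continuous_iff_continuousAt.2 fun q₀ => Metric.tendsto_nhds.2 fun ε hε => ?_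
    filter_upwards [hφ q₀ ε hε] with q hq
    rw [dist_eq_norm]
    exact hq
  have hic : Continuous i := by
    refine continuous_of_continuousAt_zero i (tendsto_def.2 fun V hV => ?_)
    rw [map_zero] at hV
    obtain ⟨ε, hε, h⟩ := hi V hV
    filter_upwards [Metric.ball_mem_nhds (0 : X) hε] with x hx
    exact h x (mem_ball_zero_iff.1 hx)
  refine ⟨i '' closure (absConvexHull 𝕜 (range φ)),
    (isCompact_closure_absConvexHull (isCompact_range hφc)).image hic,
    absConvex_absConvexHull.closure.image i, ?_⟩
  rw [range_comp]
  exact image_mono (subset_absConvexHull.trans subset_closure)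

/-- The space `E_D` as a submodule. -/
def diskSubmodule {D : Set E} (hD : AbsConvex 𝕜 D) (hne : D.Nonempty) : Submodule 𝕜 E where
  carrier := diskSpace D
  zero_mem' := ⟨1, one_pos, by simpa using hD.1.zero_mem hne⟩
  add_mem' := by
    rintro x y ⟨m, hm, hx⟩ ⟨n, hn, hy⟩
    refine ⟨m + n, by positivity, ?_⟩
    rw [Nat.cast_add, (convex_rclike_iff_convex_real.1 hD.2).add_smul (by positivity)
      (by positivity)]
    exact add_mem_add hx hy
  smul_mem' := by
    rintro c x ⟨n, hn, a, ha, rfl⟩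
    obtain ⟨N, hN⟩ := exists_nat_gt (‖c‖ * n)
    have hN0 : (0 : ℝ) < N := lt_of_le_of_lt (by positivity) hN
    refine ⟨N, by exact_mod_cast hN0, ((N : ℝ)⁻¹ : 𝕜) • (c * (n : 𝕜)) • a, ?_, ?_⟩
    · rw [smul_smul]
      refine hD.1.smul_mem ?_ ha
      rw [norm_mul, norm_inv, norm_mul, RCLike.norm_ofReal, RCLike.norm_natCast,
        abs_of_pos hN0, inv_mul_le_iff₀ hN0, mul_one]
      exact hN.le
    · simp only [RCLike.real_smul_eq_coe_smul (K := 𝕜), smul_smul]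
      congr 1
      have : ((N : ℝ) : 𝕜) ≠ 0 := by exact_mod_cast hN0.ne'
      field_simp
      simp

theorem IsLocallyComplete.exists_isCompact_absConvex_range [UniformSpace E] [IsUniformAddGroup E]
    [ContinuousSMul 𝕜 E] [T2Space E] (h : IsLocallyComplete 𝕜 E) {D : Set E} (hDc : IsClosed D)
    (hDb : Bornology.IsVonNBounded 𝕜 D) (hDa : AbsConvex 𝕜 D)
    {Q : Type*} [TopologicalSpace Q] [CompactSpace Q] (φ : Q → E) (hφD : ∀ q, φ q ∈ D)
    (hφ : ∀ q₀, ∀ ε > 0, ∀ᶠ q in 𝓝 q₀, gauge D (φ q - φ q₀) < ε) :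
    ∃ C : Set E, IsCompact C ∧ AbsConvex 𝕜 C ∧ range φ ⊆ C := by
  rcases isEmpty_or_nonempty Q with hQ | ⟨⟨q₁⟩⟩
  · exact ⟨∅, isCompact_empty, AbsConvex.empty, by rw [range_eq_empty]⟩
  have hne : D.Nonempty := ⟨φ q₁, hφD q₁⟩
  let X := diskSubmodule hDa hne
  -- `D` need not absorb `E`, but it absorbs `E_D`; there its gauge is a seminorm with unchanged
  -- values.
  let D' : Set X := {x | (x : E) ∈ D}
  have hbal : Balanced 𝕜 D' := by
    rintro c hc _ ⟨x, hx, rfl⟩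
    exact hDa.1.smul_mem hc hx
  have hconv : Convex ℝ D' := by
    have := convex_rclike_iff_convex_real.1 hDa.2
    intro x hx y hy a b ha hb hab
    exact this hx hy ha hb hab
  have habs : Absorbent ℝ D' := by
    rw [absorbent_iff_forall_absorbs_singleton]
    rintro ⟨_, n, hn, a, ha, rfl⟩
    refine absorbs_iff_norm.2 ⟨n, fun c hc => singleton_subset_iff.2 ?_⟩
    have hn0 : (0 : ℝ) < n := by exact_mod_cast hn
    have hc0 : c ≠ 0 := norm_pos_iff.1 (hn0.trans_le hc)
    rw [mem_smul_set_iff_inv_smul_mem₀ hc0]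
    change c⁻¹ • (n : ℝ) • a ∈ D
    rw [smul_smul, RCLike.real_smul_eq_coe_smul (K := 𝕜)]
    refine hDa.1.smul_mem ?_ ha
    rw [RCLike.norm_ofReal, abs_mul, abs_inv, abs_of_pos hn0,
      inv_mul_le_iff₀ (abs_pos.2 hc0), mul_one]
    exact hc
  have hg (x : X) : gauge D' x = gauge D (x : E) := by
    rw [gauge_def', gauge_def']
    rfl
  let p : Seminorm 𝕜 X := gaugeSeminorm hbal hconv habs
  have hp (x : X) : p x = gauge D (x : E) := hg x
  have hmem (q) : φ q ∈ X := ⟨1, one_pos, by simpa using hφD q⟩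
  have hi : ∀ V ∈ 𝓝 (0 : E), ∃ ε > 0, ∀ x, p x < ε → X.subtype x ∈ V := by
    intro V hV
    obtain ⟨B, ⟨hB, hBb⟩, hBV⟩ := (nhds_basis_balanced 𝕜 E).mem_iff.1 hV
    -- Boundedness of `D` makes the inclusion `E_D → E` continuous: `D ⊆ r B`, so gauge below `r⁻¹`
    -- implies membership in `B`.
    obtain ⟨r, hr, hrB⟩ := (hDb hB).exists_pos
    refine ⟨r⁻¹, inv_pos.2 hr, fun x hx => hBV ?_⟩
    obtain ⟨b, hb, hbr, y, hy, hyx⟩ := exists_lt_of_gauge_lt habs hx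
    obtain ⟨v, hv, hvy⟩ := hrB (r : 𝕜) (by simp [abs_of_pos hr]) hy
    have hx' : X.subtype x = ((b * r : ℝ) : 𝕜) • v := by
      rw [← hyx]
      change b • (y : E) = _
      rw [← hvy, RCLike.real_smul_eq_coe_smul (K := 𝕜), smul_smul, RCLike.ofReal_mul]
    rw [hx']
    refine hBb.smul_mem ?_ hv
    rw [RCLike.norm_ofReal, abs_of_pos (mul_pos hb hr)]
    exact ((lt_div_iff₀ hr).1 (by rwa [one_div])).le
  have hcomp : ∀ x : ℕ → X, (∀ ε > 0, ∃ N, ∀ m ≥ N, ∀ n ≥ N, p (x m - x n) < ε) →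
      ∃ y, Tendsto (fun n => p (x n - y)) atTop (𝓝 0) := by
    intro x hx
    obtain ⟨y, hy, hxy⟩ := h D hDc ⟨hDb, hDa⟩ (fun n => (x n : E)) (fun n => (x n).2)
      fun ε hε => by
        obtain ⟨N, hN⟩ := hx ε hε
        exact ⟨N, fun m hm n hn => (hp _).symm.trans_lt (hN m hm n hn)⟩
    exact ⟨⟨y, hy⟩, hxy.congr fun n => (hp (x n - ⟨y, hy⟩)).symm⟩
  exact exists_isCompact_absConvex_of_seminorm p X.subtype X.injective_subtype hi hcomp
    (fun q => (⟨φ q, hmem q⟩ : X)) fun q₀ ε hε =>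
      (hφ q₀ ε hε).mono fun q hq => (hp _).trans_lt hq

end LocallyComplete

/-! ### Local Lipschitz continuity into `E_D` -/

section LocalHull

variable {𝕜 : Type*} [RCLike 𝕜] {d : ℕ} {Ω : Opens (EuclideanSpace ℝ (Fin d))}
  {E : Type*} [AddCommGroup E] [Module 𝕜 E] [Module ℝ E] [IsScalarTower ℝ 𝕜 E]
  [UniformSpace E] [IsUniformAddGroup E] [ContinuousSMul 𝕜 E] [T2Space E]
  [LocallyConvexSpace ℝ E]

omit [T2Space E] in
theorem isVonNBounded_closedAbsConvexHull {s : Set E} (hs : Bornology.IsVonNBounded 𝕜 s) :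
    Bornology.IsVonNBounded 𝕜 (closedAbsConvexHull 𝕜 s) := by
  intro U hU
  obtain ⟨V, hV, hVc, hVa, hVU⟩ := exists_closed_absConvex_subset 𝕜 hU
  refine Absorbs.mono_left ?_ hVU
  filter_upwards [hs hV, Bornology.eventually_ne_cobounded (0 : 𝕜)] with c hc hc0
  exact closedAbsConvexHull_min hc ⟨hVa.1.smul c, hVa.2.smul c⟩ (hVc.smul_of_ne_zero hc0)

omit [T2Space E] in
/-- The mean value theorem for vector-valued functions on boxes. -/
theorem inv_smul_sub_mem {h : Ω → E} (hp : ∀ n, HasPartial n h) {D : Set E} (hDc : IsClosed D)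
    (hDa : AbsConvex 𝕜 D) (hne : D.Nonempty) {y z : Ω}
    (hbox : ∀ p : EuclideanSpace ℝ (Fin d), (∀ i, p i ∈ uIcc (y.1 i) (z.1 i)) →
      ∃ hpΩ : p ∈ Ω, ∀ n, partialDer n h ⟨p, hpΩ⟩ ∈ D)
    {ρ : ℝ} (hρ : 0 < ρ) (hle : ∑ i, |z.1 i - y.1 i| ≤ ρ) : (ρ : 𝕜)⁻¹ • (h z - h y) ∈ D := by
  by_contra hnot
  obtain ⟨g, hg, hg1⟩ := exists_dual_of_notMem hDc hDa hne hnot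
  -- The partial derivatives of `g ∘ h` are bounded by `1` on the box, so `g ∘ h` changes by at most
  -- `ρ`.
  have h1 := norm_sub_sub_sum_le (f := g ∘ h) (fun n => (hp n).comp g) (y := y.1) (z := z.1)
    (c := 0) (ε := 1) fun p hpbox => by
      obtain ⟨hpΩ, h2⟩ := hbox p hpbox
      refine ⟨hpΩ, fun n => ?_⟩
      rw [(hp n).partialDer_comp]
      simpa using hg _ (h2 n)
  simp only [Pi.zero_apply, smul_zero, Finset.sum_const_zero, sub_zero, one_mul,
    extendZero_apply, Function.comp_apply, ← map_sub] at h1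
  rw [map_smul, norm_smul, norm_inv, RCLike.norm_ofReal, abs_of_pos hρ,
    lt_inv_mul_iff₀ hρ, mul_one] at hg1
  exact absurd (h1.trans hle) (not_le.2 hg1)

/-- With `D` the closed absolutely convex hull of the values of `h` and its first partial
derivatives on a ball, the mean value theorem makes `h` Lipschitz for the gauge of `D` on a smaller
ball. -/
theorem IsLocallyComplete.exists_isCompact_absConvex_nhds (hE : IsLocallyComplete 𝕜 E)
    {h : Ω → E} (hc : Continuous h) (hp : ∀ n, HasPartial n h)
    (hpc : ∀ n, Continuous (partialDer n h)) (x : Ω) :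
    ∃ Q ∈ 𝓝 x, ∃ C : Set E, IsCompact C ∧ AbsConvex 𝕜 C ∧ h '' Q ⊆ C := by
  obtain ⟨R, hR, hball⟩ := Metric.nhds_basis_closedBall.mem_iff.1 (Ω.isOpen.mem_nhds x.2)
  -- Chosen so that the box spanned by two points of the ball of radius `r` stays in the ball of
  -- radius `R`.
  set r := R / (d + 1) with hr
  have hr0 : 0 < r := by positivity
  have hrR : r ≤ R := div_le_self hR.le (by linarith [(Nat.cast_nonneg d : (0 : ℝ) ≤ d)])
  let Q' : Set Ω := Subtype.val ⁻¹' Metric.closedBall (x : EuclideanSpace ℝ (Fin d)) R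
  let Q : Set Ω := Subtype.val ⁻¹' Metric.closedBall (x : EuclideanSpace ℝ (Fin d)) r
  have hQ' : IsCompact Q' := isCompact_preimage_val hball (isCompact_closedBall _ _)
  have hQ : IsCompact Q := isCompact_preimage_val
    ((Metric.closedBall_subset_closedBall hrR).trans hball) (isCompact_closedBall _ _)
  let s : Set E := (⋃ n, partialDer n h '' Q') ∪ h '' Q'
  have hs : IsCompact s := (isCompact_iUnion fun n => hQ'.image (hpc n)).union (hQ'.image hc)
  let D := closedAbsConvexHull 𝕜 s
  have hsD : s ⊆ D := subset_closedAbsConvexHull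
  have hQD (q : Ω) (hq : q ∈ Q) : h q ∈ D := hsD (.inr
    (mem_image_of_mem h (Metric.closedBall_subset_closedBall hrR hq)))
  have hDa : AbsConvex 𝕜 D := absConvex_convexClosedHull
  have := isCompact_iff_compactSpace.1 hQ
  have hgauge (y z : Q) {ρ : ℝ} (hρ : 0 < ρ) (hle : ∑ i, |z.1.1 i - y.1.1 i| ≤ ρ) :
      gauge D (h z - h y) ≤ ρ := by
    refine gauge_le_of_mem hρ.le ?_
    rw [mem_smul_set_iff_inv_smul_mem₀ hρ.ne', RCLike.real_smul_eq_coe_smul (K := 𝕜),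
      RCLike.ofReal_inv]
    refine inv_smul_sub_mem hp isClosed_closedAbsConvexHull hDa ⟨_, hQD y y.2⟩ (fun p hpbox => ?_)
      hρ hle
    have hpR : p ∈ Metric.closedBall (x : EuclideanSpace ℝ (Fin d)) R := by
      have := dist_le_of_mem_box (x := (x : EuclideanSpace ℝ (Fin d))) y.2 z.2 hpbox
      rwa [hr, mul_div_cancel₀ _ (by positivity)] at this
    exact ⟨hball hpR, fun n => hsD (.inl (mem_iUnion_of_mem n (mem_image_of_mem _ hpR)))⟩
  obtain ⟨C, hC, hCa, hsub⟩ := hE.exists_isCompact_absConvex_range (D := D)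
    isClosed_closedAbsConvexHull (isVonNBounded_closedAbsConvexHull (hs.isVonNBounded 𝕜)) hDa
    (fun q : Q => h q) (fun q => hQD q q.2) fun q₀ ε hε => by
      have h1 : Continuous fun q : Q => ∑ i, |q.1.1 i - q₀.1.1 i| := by fun_prop
      have h2 := (h1.tendsto q₀).eventually_lt_const
        (show ∑ i, |q₀.1.1 i - q₀.1.1 i| < ε / 2 by simpa using hε)
      filter_upwards [h2] with q hq
      exact (hgauge q₀ q (half_pos hε) hq.le).trans_lt (half_lt_self hε)
  refine ⟨Q, continuous_subtype_val.continuousAt.preimage_mem_nhds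
    (Metric.closedBall_mem_nhds _ hr0), C, hC, hCa, ?_⟩
  rwa [← range_domRestrict]

/-- For `k = ∞` every `∂^β f` has continuous first partial derivatives, so the local result applies;
finitely many of the local compact sets are combined over `K`. -/
theorem IsLocallyComplete.exists_isCompact_absConvex (hE : IsLocallyComplete 𝕜 E)
    (f : CW 𝕜 ⊤ Ω E) (β : Fin d → ℕ) {K : Set Ω} (hK : IsCompact K) :
    ∃ C : Set E, IsCompact C ∧ AbsConvex 𝕜 C ∧ iterPartial β (f : Ω → E) '' K ⊆ C := by
  rw [iterPartial_eq_wordDer]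
  refine hK.induction_on
    (p := fun A => ∃ C : Set E, IsCompact C ∧ AbsConvex 𝕜 C ∧ wordDer _ (f : Ω → E) '' A ⊆ C)
    ⟨∅, isCompact_empty, AbsConvex.empty, by simp⟩ ?_ ?_ ?_
  · rintro A B hAB ⟨C, hC, hCa, hBC⟩
    exact ⟨C, hC, hCa, (image_mono hAB).trans hBC⟩
  · rintro A B ⟨C, hC, hCa, hAC⟩ ⟨D, hD, hDa, hBD⟩
    obtain ⟨G, hG, hGa, hCG, hDG⟩ := exists_isCompact_absConvex_union hC hCa hD hDa
    exact ⟨G, hG, hGa, by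
      rw [image_union]; exact union_subset (hAC.trans hCG) (hBD.trans hDG)⟩
  · intro x _
    obtain ⟨Q, hQ, h⟩ := hE.exists_isCompact_absConvex_nhds (f.continuous_wordDer le_top)
      (fun n => f.hasPartial_wordDer le_top)
      (fun n => f.continuous_wordDer (w := n :: multiIndexWord β) le_top) x
    exact ⟨Q, mem_nhdsWithin_of_mem_nhds hQ, h⟩

end LocalHull

/-! ### The isomorphism theorem -/

theorem mainTheorem8 {𝕜 : Type*} [RCLike 𝕜] {E : Type*} [AddCommGroup E] [Module 𝕜 E]
    [Module ℝ E] [IsScalarTower ℝ 𝕜 E] [UniformSpace E] [IsUniformAddGroup E]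
    [ContinuousSMul 𝕜 E] [T2Space E] [LocallyConvexSpace ℝ E]
    {d : ℕ} (Ω : TopologicalSpace.Opens (EuclideanSpace ℝ (Fin d))) (k : ℕ∞)
    (h : (k < ⊤ ∧ HasMetricCCP 𝕜 E) ∨ (k = ⊤ ∧ IsLocallyComplete 𝕜 E)) :
    ∃ S : EpsProduct 𝕜 (CW 𝕜 k Ω 𝕜) E ≃L[𝕜] CW 𝕜 k Ω E,
      ∀ (u : EpsProduct 𝕜 (CW 𝕜 k Ω 𝕜) E) (x : Ω), S u x = u (pointEval 𝕜 k x) := by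
  refine exists_continuousLinearEquiv fun f β K hK => ?_
  rcases h with ⟨-, h⟩ | ⟨rfl, h⟩
  · exact h.exists_isCompact_absConvex f β.2 hK
  · exact h.exists_isCompact_absConvex f β.1 hK
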